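/- Let $r\ge k\ge 3$ be integers. For $n\ge 1$ let $\Omega_n^r$ be the set of all simplicial subcomplexes $Y$ (possibly empty) of the simplex $\Delta_n$ with vertex set $\{1,\dots,n\}$ such that $\dim Y\le r$. For $\mathfrak p=(p_0,\dots,p_r)\in[0,1]^{r+1}$ give $\Omega_n^r$ the probability $$\mathbb P_{r,\mathfrak p}(Y)=\prod_{i=0}^r p_i^{f_i(Y)}\cdot\prod_{i=0}^r(1-p_i)^{e_i(Y)}\qquad(0^0=1),$$ where $f_i(Y)$ is the number of $i$-dimensional simplexes of $Y$ and $e_i(Y)$ is the number of $i$-dimensional simplexes $\sigma$ of $\Delta_n$ with $\sigma\not\subset Y$ and $\partial\sigma\subset Y$. For $\alpha=(\alpha_0,\dots,\alpha_r)$ with all $\alpha_i\ge 0$ put $\psi_j(\alpha)=\sum_{i=0}^r\binom ji\alpha_i$, and let $\mathfrak D_k\subset\mathbb R_{\ge 0}^{r+1}$ be the set of $\alpha$ with $\psi_k(\alpha)<1<\psi_{k+1}(\alpha)$ if $k<r$, and with $\psi_r(\alpha)<1$ if $k=r$. Let $\alpha(n)=(\alpha_0(n),\dots,\alpha_r(n))\in\mathbb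 R_{\ge 0}^{r+1}$ be a sequence of vectors converging to a vector $\alpha_*\in\mathfrak D_k$, and let $Y\in\Omega_n^r$ be random with respect to $\mathbb P_{r,\mathfrak p}$, where $p_i=n^{-\alpha_i(n)}$ for $i=0,\dots,r$. Then $Y$ is simply connected asymptotically almost surely: the probability that the geometric realization of $Y$ is (nonempty and) path-connected with trivial fundamental group tends to $1$ as $n\to\infty$. -/

import Mathlib

open Filter Topology

namespace RandomComplex

/-- The sample space `Ω_n^r`: all simplicial subcomplexes `Y` (the empty one included) of the
simplex on `n` vertices, with `dim Y ≤ r`. -/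
def Omega (n r : ℕ) : Type :=
  {Y : PreAbstractSimplicialComplex (Fin n) // ∀ σ ∈ Y.faces, σ.card ≤ r + 1}

instance (n r : ℕ) : Finite (Omega n r) :=
  Finite.of_injective (fun Y : Omega n r => Y.1.faces)
    (fun _ _ h => Subtype.ext (PreAbstractSimplicialComplex.ext h))

noncomputable instance (n r : ℕ) : Fintype (Omega n r) := Fintype.ofFinite _

/-- `f_i(Y)`: the number of `i`-dimensional faces of `Y`. -/
noncomputable def numFaces {n : ℕ} (Y : PreAbstractSimplicialComplex (Fin n)) (i : ℕ) : ℕ :=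
  {σ : Finset (Fin n) | σ.card = i + 1 ∧ σ ∈ Y.faces}.ncard

/-- `e_i(Y)`: the number of `i`-dimensional external faces of `Y`, i.e. of `i`-simplices that are
not in `Y` but whose boundary (all nonempty proper subsets) is contained in `Y`. -/
noncomputable def numExternalFaces {n : ℕ} (Y : PreAbstractSimplicialComplex (Fin n)) (i : ℕ) : ℕ :=
  {σ : Finset (Fin n) | σ.card = i + 1 ∧ σ ∉ Y.faces ∧
    ∀ τ : Finset (Fin n), τ ⊂ σ → τ.Nonempty → τ ∈ Y.faces}.ncard

/-- The probability function `P_{r,p}(Y) = ∏ p_i ^ f_i(Y) * ∏ (1 - p_i) ^ e_i(Y)`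
(with `0 ^ 0 = 1`). -/
noncomputable def weight {n r : ℕ} (p : Fin (r + 1) → ℝ) (Y : Omega n r) : ℝ :=
  (∏ i : Fin (r + 1), p i ^ numFaces Y.1 i) *
    ∏ i : Fin (r + 1), (1 - p i) ^ numExternalFaces Y.1 i

open Classical in
/-- The probability of an event `E ⊆ Ω_n^r`. -/
noncomputable def prob {n r : ℕ} (p : Fin (r + 1) → ℝ) (E : Set (Omega n r)) : ℝ :=
  ∑ Y : Omega n r with Y ∈ E, weight p Y

/-- The linear function `ψ_k(α) = ∑_{i=0}^r (k choose i) α_i`. -/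
noncomputable def psi {r : ℕ} (k : ℕ) (α : Fin (r + 1) → ℝ) : ℝ :=
  ∑ i : Fin (r + 1), (k.choose i : ℝ) * α i

/-- The domain `𝔇_k` of nonnegative vectors, for `0 ≤ k ≤ r`: it is given by `ψ_k < 1 < ψ_{k+1}`
when `k < r`, and by `ψ_r < 1` when `k = r`. -/
def criticalDomain (r k : ℕ) : Set (Fin (r + 1) → ℝ) :=
  {α | (∀ i, 0 ≤ α i) ∧ psi k α < 1 ∧ (k < r → 1 < psi (k + 1) α)}

open Classical in
/-- The geometric realization of a complex on the vertices `Fin n`, in barycentric coordinates: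
points of the standard simplex whose support is a face. It has the subspace topology. -/
def realization {n : ℕ} (Y : PreAbstractSimplicialComplex (Fin n)) : Set (Fin n → ℝ) :=
  {x | x ∈ stdSimplex ℝ (Fin n) ∧ Finset.univ.filter (fun v => x v ≠ 0) ∈ Y.faces}

end RandomComplex

/-!
The parameters enter only through `α₀ + 3 α₁ + 3 α₂ < 1`, which holds near the limit vector because
`ψ_k` dominates this form for `k ≥ 3`. It says that `m = n p₀ p₁³ p₂³`, up to lower order the
expected number of vertices `w` joined to three given vertices and to the three edges between them,
is at least a positive power of `n`.

*Topology.* A complex is covered by the open stars of its vertices. These and their nonempty pairwise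
intersections are star convex, so a van Kampen argument (`simplyConnectedSpace_of_openCover`) gives
simple connectivity as soon as every three vertices have a common neighbour, every triangle graph is
the base of a cone, and the common neighbours of any two distinct vertices form a connected graph
(`simplyConnectedSpace_realization`). Indeed, fix a base vertex `b` and choose as path class from `b`
to `v` the one through a common neighbour `w` of `b` and `v`. Replacing `w` by an adjacent common
neighbour does not change the class, because triangle graphs are null homotopic, so the class is
independent of `w`. A common neighbour of `b`, `v` and `v'` then shows that the classes are compatible
with the edge from `v` to `v'`.

*Probability.* The random complex is generated by independent coins, one for each simplex
(`prob_eq_coinMeasure_real`). The events that different vertices `w` are apexes of cones over a given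
triangle use different coins, so all of them fail with probability at most `exp (-m / 2)`. For the
graph of common neighbours of `u` and `v`, put `t = ⌊1 / p₁⌋`. A nonempty set `S` of at most `t`
vertices is joined to a further common neighbour, and two disjoint sets of size `t` are joined to one
common neighbour, except with probability exponentially small in `m` times the size of the sets
(`coinMeasure_real_not_hits_le`). This survives the union bound over the sets
(`coinMeasure_real_not_simplyConnected_le`). Hence components of that graph have at least `t` vertices
and two of them cannot be distinct (`simplyConnectedSpace_ofCoins`).
-/

/-! ### Simple connectivity from an open cover -/

section OpenCover

open Path.Homotopic (Quotient)
open Path.Homotopic.Quotient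

/-- Path classes of `X` are determined by their endpoints as soon as the members of an open cover
have a compatible choice of classes from a fixed base point: for every path `γ` from `x` to `y`
inside a member of the cover, the class chosen for `y` is the class chosen for `x` followed
by `γ`. -/
theorem simplyConnectedSpace_of_openCover_of_classes {X ι : Type*} [TopologicalSpace X]
    {U : ι → Set X} (hU : ∀ i, IsOpen (U i)) (hcov : ∀ x, ∃ i, x ∈ U i) (b : X)
    (h : ∀ x, Path.Homotopic.Quotient b x)
    (hloc : ∀ i, ∀ x y : X, ∀ γ : Path x y, (∀ t, γ t ∈ U i) → trans (h x) (mk γ) = h y) :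
    SimplyConnectedSpace X := by
  have key : ∀ x y : X, ∀ γ : Path x y, trans (h x) (mk γ) = h y := by
    intro x y γ
    obtain ⟨t, t0, tmono, ⟨N, hN⟩, ht⟩ := exists_monotone_Icc_subset_open_cover_unitInterval
      (fun i => (hU i).preimage γ.continuous)
      (fun s _ => Set.mem_iUnion.2 (hcov (γ s)))
    have step : ∀ n, trans (h (γ 0)) (mk (γ.subpath 0 (t n))) = h (γ (t n)) := by
      intro n
      induction n with
      | zero => rw [t0, Path.subpath_self, mk_refl, trans_refl]
      | succ n ih =>
        obtain ⟨i, hi⟩ := ht n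
        have h1 : mk (γ.subpath 0 (t (n + 1)))
            = trans (mk (γ.subpath 0 (t n))) (mk (γ.subpath (t n) (t (n + 1)))) := by
          rw [← mk_trans, Path.Homotopic.Quotient.eq]
          exact ⟨(Path.Homotopy.subpathTransSubpath γ 0 (t n) (t (n + 1))).symm⟩
        rw [h1, ← trans_assoc, ih]
        refine hloc i _ _ _ fun s => ?_
        have := Set.mem_range_self (f := γ.subpath (t n) (t (n + 1))) s
        rw [Path.range_subpath_of_le _ _ _ (tmono n.le_succ)] at this
        obtain ⟨s', hs', he⟩ := this
        rw [← he]
        exact hi hs'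
    have h1 := step N
    rw [hN N le_rfl, Path.subpath_zero_one] at h1
    have cast_eq : ∀ {x' y' : X} (hx : x' = x) (hy : y' = y),
        (h x').trans (mk (γ.cast hx hy)) = h y' → (h x).trans (mk γ) = h y := by
      rintro _ _ rfl rfl h'
      exact h'
    exact cast_eq _ _ h1
  rw [simply_connected_iff_paths_homotopic]
  refine ⟨⟨⟨b⟩, fun x y => ?_⟩, fun x y => ⟨fun p q => ?_⟩⟩
  · have hb : ∀ z, Joined b z := fun z => by
      obtain ⟨p, -⟩ := mk_surjective (h z)
      exact ⟨p⟩
    exact (hb x).symm.trans (hb y)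
  · induction p using Path.Homotopic.Quotient.ind with | mk p =>
    induction q using Path.Homotopic.Quotient.ind with | mk q =>
    have e : trans (h x) (mk p) = trans (h x) (mk q) := (key _ _ p).trans (key _ _ q).symm
    have e' := congrArg (fun c => (h x).symm.trans c) e
    simpa [← trans_assoc] using e'

/-- Inside a simply connected subset, path classes of the ambient space depend only on the
endpoints. -/
theorem IsSimplyConnected.mk_eq_mk {X : Type*} [TopologicalSpace X] {s : Set X}
    (hs : IsSimplyConnected s) {x y : X} (p q : Path x y) (hp : ∀ t, p t ∈ s)
    (hq : ∀ t, q t ∈ s) : mk p = mk q := by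
  have := hs.simplyConnectedSpace
  have hx : x ∈ s := by simpa using hp 0
  have hy : y ∈ s := by simpa using hp 1
  let p' : Path (⟨x, hx⟩ : s) ⟨y, hy⟩ :=
    { toFun := fun t => ⟨p t, hp t⟩, source' := by simp, target' := by simp }
  let q' : Path (⟨x, hx⟩ : s) ⟨y, hy⟩ :=
    { toFun := fun t => ⟨q t, hq t⟩, source' := by simp, target' := by simp }
  have h := (simply_connected_iff_paths_homotopic'.1 this).2 p' q'
  have h2 := h.map ⟨Subtype.val, continuous_subtype_val⟩
  exact Path.Homotopic.Quotient.eq.2 h2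

theorem Path.Homotopic.Quotient.symm_trans_cancel_left {X : Type*} [TopologicalSpace X] {x y z : X}
    (p : Path.Homotopic.Quotient x y) (q : Path.Homotopic.Quotient y z) :
    p.symm.trans (p.trans q) = q := by
  rw [← trans_assoc, symm_trans, refl_trans]

theorem Path.Homotopic.Quotient.trans_trans_symm {X : Type*} [TopologicalSpace X] {x y z w : X}
    (p : Path.Homotopic.Quotient x z) (q : Path.Homotopic.Quotient y z)
    (γ : Path.Homotopic.Quotient z w) :
    (p.trans γ).trans (q.trans γ).symm = p.trans q.symm := by
  have h : γ.trans (q.trans γ).symm = q.symm := by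
    rw [← symm_trans_cancel_left q (γ.trans (q.trans γ).symm), ← trans_assoc q, trans_symm,
      trans_refl]
  rw [trans_assoc, h]

/-- A van Kampen type criterion. Suppose that `X` has an open cover by simply connected sets whose
nonempty pairwise intersections are path connected, and that in the nerve of this cover every empty
or full triangle is filled by a cone, any three vertices have a common neighbour, and the common
neighbours of two distinct vertices form a connected graph. Then `X` is simply connected.

The class `g i` of a path from the base vertex `b` to the vertex `i` is defined by passing through a
common neighbour of `b` and `i`. Connectedness makes it independent of that neighbour, and a common
neighbour of `b`, `i`, `j` shows that `g i` followed by the edge from `i` to `j` is `g j`. -/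
theorem simplyConnectedSpace_of_openCover {X ι : Type*} [TopologicalSpace X] {U : ι → Set X}
    (hU : ∀ i, IsOpen (U i)) (hcov : ∀ x, ∃ i, x ∈ U i) (hsc : ∀ i, IsSimplyConnected (U i))
    (hint : ∀ i j, (U i ∩ U j).Nonempty → IsPathConnected (U i ∩ U j)) [Nonempty ι]
    (hcone : ∀ i j k, (U i ∩ U j).Nonempty → (U j ∩ U k).Nonempty → (U i ∩ U k).Nonempty →
      ∃ l, (U i ∩ U j ∩ U l).Nonempty ∧ (U j ∩ U k ∩ U l).Nonempty ∧ (U i ∩ U k ∩ U l).Nonempty)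
    (hnbr : ∀ i j k, ∃ l, (U i ∩ U l).Nonempty ∧ (U j ∩ U l).Nonempty ∧ (U k ∩ U l).Nonempty)
    (hconn : ∀ i j, i ≠ j → ∀ l l', (U i ∩ U l).Nonempty → (U j ∩ U l).Nonempty →
      (U i ∩ U l').Nonempty → (U j ∩ U l').Nonempty →
      Relation.ReflTransGen (fun a a' => (U a ∩ U a').Nonempty ∧
        (U i ∩ U a').Nonempty ∧ (U j ∩ U a').Nonempty) l l') :
    SimplyConnectedSpace X := by
  classical
  choose x hx using fun i => (hsc i).nonempty
  -- `c i y` is the class of the paths from the base point of `U i` to `y` inside `U i`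
  have hc : ∀ i y, y ∈ U i → ∃ c : Path.Homotopic.Quotient (x i) y,
      ∃ p : Path (x i) y, (∀ t, p t ∈ U i) ∧ c = mk p := fun i y hy =>
    let ⟨p, hp⟩ := (hsc i).isPathConnected.joinedIn _ (hx i) _ hy
    ⟨mk p, p, hp, rfl⟩
  choose c p hp hcp using hc
  have c_trans : ∀ i y y' (hy : y ∈ U i) (hy' : y' ∈ U i) (γ : Path y y'), (∀ t, γ t ∈ U i) →
      (c i y hy).trans (mk γ) = c i y' hy' := by
    intro i y y' hy hy' γ hγ
    rw [hcp i y hy, hcp i y' hy', ← mk_trans]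
    refine (hsc i).mk_eq_mk _ _ (fun t => ?_) (hp i y' hy')
    have := Set.mem_range_self (f := (p i y hy).trans γ) t
    rw [Path.trans_range] at this
    rcases this with ⟨s, hs⟩ | ⟨s, hs⟩
    · exact hs ▸ hp i y hy s
    · exact hs ▸ hγ s
  -- the class of the edge from `i` to `j` does not depend on the point where it changes over
  have e_indep : ∀ i j y y' (hy : y ∈ U i) (hy2 : y ∈ U j) (hy' : y' ∈ U i) (hy2' : y' ∈ U j),
      (c i y hy).trans (c j y hy2).symm = (c i y' hy').trans (c j y' hy2').symm := by
    intro i j y y' hy hy2 hy' hy2'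
    obtain ⟨γ, hγ⟩ := (hint i j ⟨y, hy, hy2⟩).joinedIn _ ⟨hy, hy2⟩ _ ⟨hy', hy2'⟩
    rw [← c_trans i y y' hy hy' γ fun t => (hγ t).1]
    rw [← c_trans j y y' hy2 hy2' γ fun t => (hγ t).2, trans_trans_symm]
  let e : ∀ i j, (U i ∩ U j).Nonempty → Path.Homotopic.Quotient (x i) (x j) := fun i j h =>
    (c i h.some h.some_mem.1).trans (c j h.some h.some_mem.2).symm
  have e_eq : ∀ i j (h : (U i ∩ U j).Nonempty) y (hy : y ∈ U i) (hy2 : y ∈ U j),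
      e i j h = (c i y hy).trans (c j y hy2).symm := fun i j h y hy hy2 =>
    e_indep i j _ _ _ _ _ _
  clear_value e
  have e_symm : ∀ i j (h : (U i ∩ U j).Nonempty) (h' : (U j ∩ U i).Nonempty),
      (e i j h).trans (e j i h') = Path.Homotopic.Quotient.refl _ := by
    intro i j h h'
    rw [e_eq i j h _ h.some_mem.1 h.some_mem.2, e_eq j i h' _ h.some_mem.2 h.some_mem.1,
      trans_assoc, symm_trans_cancel_left, trans_symm]
  have e_tri₀ : ∀ i j k (hij : (U i ∩ U j).Nonempty) (hjk : (U j ∩ U k).Nonempty)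
      (hik : (U i ∩ U k).Nonempty), (U i ∩ U j ∩ U k).Nonempty →
      (e i j hij).trans (e j k hjk) = e i k hik := by
    rintro i j k hij hjk hik ⟨y, ⟨hyi, hyj⟩, hyk⟩
    rw [e_eq i j _ y hyi hyj, e_eq j k _ y hyj hyk, e_eq i k _ y hyi hyk,
      trans_assoc, symm_trans_cancel_left]
  have swap : ∀ {i j}, (U i ∩ U j).Nonempty → (U j ∩ U i).Nonempty := fun h => by
    rwa [Set.inter_comm]
  have e_tri : ∀ i j k (hij : (U i ∩ U j).Nonempty) (hjk : (U j ∩ U k).Nonempty)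
      (hik : (U i ∩ U k).Nonempty), (e i j hij).trans (e j k hjk) = e i k hik := by
    intro i j k hij hjk hik
    obtain ⟨l, hijl, hjkl, hikl⟩ := hcone i j k hij hjk hik
    have hil : (U i ∩ U l).Nonempty := hijl.mono fun _ h => ⟨h.1.1, h.2⟩
    have hjl : (U j ∩ U l).Nonempty := hijl.mono fun _ h => ⟨h.1.2, h.2⟩
    have hkl : (U k ∩ U l).Nonempty := hjkl.mono fun _ h => ⟨h.1.2, h.2⟩
    have h1 := e_tri₀ i j l hij hjl hil hijl
    have h2 := e_tri₀ j k l hjk hkl hjl hjkl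
    have h3 := e_tri₀ i k l hik hkl hil hikl
    have h4 := e_symm k l hkl (swap hkl)
    calc (e i j hij).trans (e j k hjk)
        = (e i j hij).trans ((e j k hjk).trans ((e k l hkl).trans (e l k (swap hkl)))) := by
          rw [h4, trans_refl]
      _ = (((e i j hij).trans ((e j k hjk).trans (e k l hkl)))).trans (e l k (swap hkl)) := by
          simp only [trans_assoc]
      _ = ((e i k hik).trans (e k l hkl)).trans (e l k (swap hkl)) := by rw [h2, h1, h3]
      _ = e i k hik := by rw [trans_assoc, h4, trans_refl]
  obtain ⟨b⟩ := ‹Nonempty ι›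
  choose m hbm hm _ using fun i => hnbr b i i
  let g : ∀ i, Path.Homotopic.Quotient (x b) (x i) := fun i =>
    (e b (m i) (hbm i)).trans (e (m i) i (swap (hm i)))
  have g_eq : ∀ i l (hbl : (U b ∩ U l).Nonempty) (hli : (U l ∩ U i).Nonempty),
      (e b l hbl).trans (e l i hli) = g i := by
    intro i l hbl hli
    by_cases hbi : b = i
    · subst hbi
      rw [e_symm]
      exact (e_symm _ _ _ _).symm
    have := hconn b i hbi (m i) l (hbm i) (hm i) hbl (swap hli)
    suffices ∀ l', Relation.ReflTransGen (fun a a' => (U a ∩ U a').Nonempty ∧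
        (U b ∩ U a').Nonempty ∧ (U i ∩ U a').Nonempty) (m i) l' → ∃ (h : (U b ∩ U l').Nonempty)
        (h' : (U l' ∩ U i).Nonempty), (e b l' h).trans (e l' i h') = g i from
      (this l ‹_›).2.2
    intro l' hl'
    induction hl' with
    | refl => exact ⟨hbm i, swap (hm i), rfl⟩
    | @tail a a' _ haa' ih =>
      obtain ⟨h, h', ih⟩ := ih
      obtain ⟨h1, h2, h3⟩ := haa'
      refine ⟨h2, swap h3, ?_⟩
      rw [← ih, ← e_tri a a' i h1 (swap h3) h', ← trans_assoc, e_tri b a a' h h1 h2]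
  have g_edge : ∀ i j (hij : (U i ∩ U j).Nonempty), (g i).trans (e i j hij) = g j := by
    intro i j hij
    obtain ⟨l, hb, hi, hj⟩ := hnbr b i j
    rw [← g_eq i l hb (swap hi), ← g_eq j l hb (swap hj), trans_assoc,
      e_tri l i j (swap hi) hij (swap hj)]
  clear_value g
  choose o ho using hcov
  refine simplyConnectedSpace_of_openCover_of_classes hU (fun y => ⟨o y, ho y⟩) (x b)
    (fun y => (g (o y)).trans (c (o y) y (ho y))) fun i y y' γ hγ => ?_
  have change : ∀ z (hz : z ∈ U i),
      (g (o z)).trans (c (o z) z (ho z)) = (g i).trans (c i z hz) := by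
    intro z hz
    have hoi : (U (o z) ∩ U i).Nonempty := ⟨z, ho z, hz⟩
    rw [← g_edge (o z) i hoi, e_eq (o z) i hoi z (ho z) hz, trans_assoc,
      trans_assoc, symm_trans, trans_refl]
  have hy : y ∈ U i := by simpa using hγ 0
  have hy' : y' ∈ U i := by simpa using hγ 1
  simp only [change y hy, change y' hy', trans_assoc, c_trans i y y' hy hy' γ hγ]

end OpenCover

/-! ### Open stars in the geometric realization -/

namespace RandomComplex

theorem mem_faces_of_subset {n : ℕ} {Y : PreAbstractSimplicialComplex (Fin n)}
    {σ τ : Finset (Fin n)} (hσ : σ ∈ Y.faces) (hτ : τ ⊆ σ) (hne : τ.Nonempty) : τ ∈ Y.faces :=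
  (Y.isRelLowerSet_faces hσ).2 hτ hne

/-- The open star of a set `S` of vertices in the realization of `Y`: the points all of whose
barycentric coordinates at the vertices of `S` are positive. -/
def openStar {n : ℕ} (Y : PreAbstractSimplicialComplex (Fin n)) (S : Finset (Fin n)) :
    Set (Fin n → ℝ) :=
  {x | x ∈ realization Y ∧ ∀ v ∈ S, 0 < x v}

/-- The barycenter of the simplex spanned by `S`, in barycentric coordinates. -/
noncomputable def barycenter {n : ℕ} (S : Finset (Fin n)) : Fin n → ℝ :=
  fun v => if v ∈ S then (S.card : ℝ)⁻¹ else 0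

theorem barycenter_mem_openStar {n : ℕ} {Y : PreAbstractSimplicialComplex (Fin n)}
    {S : Finset (Fin n)} (hS : S ∈ Y.faces) : barycenter S ∈ openStar Y S := by
  classical
  have hne : S.Nonempty := (Y.isRelLowerSet_faces hS).1
  have hc : 0 < (S.card : ℝ) := by exact_mod_cast hne.card_pos
  refine ⟨⟨⟨fun v => ?_, ?_⟩, ?_⟩, fun v hv => ?_⟩
  · unfold barycenter
    split_ifs <;> positivity
  · simp [barycenter, hc.ne']
  · convert hS
    ext v
    simp [barycenter, hne.ne_empty]
  · simp only [barycenter, hv, if_true]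
    positivity

theorem openStar_nonempty_iff {n : ℕ} {Y : PreAbstractSimplicialComplex (Fin n)}
    {S : Finset (Fin n)} (hS : S.Nonempty) : (openStar Y S).Nonempty ↔ S ∈ Y.faces := by
  refine ⟨?_, fun h => ⟨_, barycenter_mem_openStar h⟩⟩
  rintro ⟨x, hx, hpos⟩
  refine mem_faces_of_subset hx.2 (fun v hv => ?_) hS
  simpa using (hpos v hv).ne'

/-- Open stars of simplices are star convex about the barycenter of the simplex. -/
theorem starConvex_openStar {n : ℕ} {Y : PreAbstractSimplicialComplex (Fin n)}
    {S : Finset (Fin n)} (hS : S ∈ Y.faces) : StarConvex ℝ (barycenter S) (openStar Y S) := by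
  classical
  rintro x ⟨⟨hxs, hxf⟩, hpos⟩ a b ha hb hab
  obtain ⟨⟨hbs, -⟩, hbpos⟩ := barycenter_mem_openStar hS
  have key : ∀ v ∈ S, 0 < (a • barycenter S + b • x) v := by
    intro v hv
    simp only [Pi.add_apply, Pi.smul_apply, smul_eq_mul]
    rcases ha.eq_or_lt with rfl | ha'
    · rw [zero_add] at hab
      simpa [hab] using hpos v hv
    · have := mul_pos ha' (hbpos v hv)
      have := mul_nonneg hb (hpos v hv).le
      linarith
  refine ⟨⟨convex_stdSimplex ℝ (Fin n) hbs hxs ha hb hab, ?_⟩, key⟩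
  refine mem_faces_of_subset hxf (fun v => ?_) ?_
  · simp only [Finset.mem_filter, Finset.mem_univ, true_and]
    contrapose!
    intro h0
    have hvS : v ∉ S := fun hv => (hpos v hv).ne' h0
    simp [barycenter, hvS, h0]
  · obtain ⟨v, hv⟩ := (Y.isRelLowerSet_faces hS).1
    exact ⟨v, by simpa using (key v hv).ne'⟩

theorem isSimplyConnected_openStar {n : ℕ} {Y : PreAbstractSimplicialComplex (Fin n)}
    {S : Finset (Fin n)} (hS : S ∈ Y.faces) :
    IsSimplyConnected {x : realization Y | ∀ v ∈ S, 0 < x.1 v} := by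
  rw [← Topology.IsEmbedding.subtypeVal.isSimplyConnected_image]
  have : Subtype.val '' {x : realization Y | ∀ v ∈ S, 0 < x.1 v} = openStar Y S := by
    ext x
    simp [openStar, and_comm]
  rw [this]
  have := (starConvex_openStar hS).contractibleSpace ⟨_, barycenter_mem_openStar hS⟩
  exact SimplyConnectedSpace.ofContractible _

/-- A criterion for simple connectivity in terms of faces of dimension at most two: every three
vertices have a common neighbour, every three pairwise adjacent vertices bound a cone, and the
common neighbours of two distinct vertices form a connected graph. It is the criterion for covers,
applied to the open stars of the vertices. -/
theorem simplyConnectedSpace_realization {n : ℕ} {Y : PreAbstractSimplicialComplex (Fin n)}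
    (hne : ∃ v, {v} ∈ Y.faces)
    (hnbr : ∀ a b c, {a} ∈ Y.faces → {b} ∈ Y.faces → {c} ∈ Y.faces →
      ∃ l, {a, l} ∈ Y.faces ∧ {b, l} ∈ Y.faces ∧ {c, l} ∈ Y.faces)
    (hcone : ∀ a b c, {a, b} ∈ Y.faces → {b, c} ∈ Y.faces → {a, c} ∈ Y.faces →
      ∃ l, {a, b, l} ∈ Y.faces ∧ {b, c, l} ∈ Y.faces ∧ {a, c, l} ∈ Y.faces)
    (hconn : ∀ a b, a ≠ b → ∀ l l', {a, l} ∈ Y.faces → {b, l} ∈ Y.faces →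
      {a, l'} ∈ Y.faces → {b, l'} ∈ Y.faces →
      Relation.ReflTransGen
        (fun s t => {s, t} ∈ Y.faces ∧ {a, t} ∈ Y.faces ∧ {b, t} ∈ Y.faces) l l') :
    SimplyConnectedSpace (realization Y) := by
  have stars : ∀ S : Finset (Fin n), S.Nonempty →
      ({x : realization Y | ∀ v ∈ S, 0 < x.1 v}.Nonempty ↔ S ∈ Y.faces) := by
    intro S hS
    rw [← openStar_nonempty_iff hS]
    exact ⟨fun ⟨x, hx⟩ => ⟨x.1, x.2, hx⟩, fun ⟨x, hx, h⟩ => ⟨⟨x, hx⟩, h⟩⟩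
  let U : {v : Fin n // {v} ∈ Y.faces} → Set (realization Y) := fun v => {x | 0 < x.1 v}
  have hU2 : ∀ i j, U i ∩ U j = {x | ∀ v ∈ ({i.1, j.1} : Finset (Fin n)), 0 < x.1 v} := by
    intro i j
    ext x
    simp [U]
  have hU3 : ∀ i j k,
      U i ∩ U j ∩ U k = {x | ∀ v ∈ ({i.1, j.1, k.1} : Finset (Fin n)), 0 < x.1 v} := by
    intro i j k
    ext x
    simp [U, and_assoc]
  have hne2 : ∀ i j, (U i ∩ U j).Nonempty ↔ {i.1, j.1} ∈ Y.faces := fun i j => by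
    rw [hU2, stars _ (Finset.insert_nonempty _ _)]
  have hne3 : ∀ i j k, (U i ∩ U j ∩ U k).Nonempty ↔ {i.1, j.1, k.1} ∈ Y.faces := fun i j k => by
    rw [hU3, stars _ (Finset.insert_nonempty _ _)]
  have vertex : ∀ {a l : Fin n}, {a, l} ∈ Y.faces → {l} ∈ Y.faces := fun h =>
    mem_faces_of_subset h (by simp) (Finset.singleton_nonempty _)
  have : Nonempty {v : Fin n // {v} ∈ Y.faces} := ⟨⟨_, hne.choose_spec⟩⟩
  refine simplyConnectedSpace_of_openCover (U := U) (fun i => ?_) (fun x => ?_) (fun i => ?_)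
    (fun i j h => ?_) (fun i j k hij hjk hik => ?_) (fun i j k => ?_) (fun i j hij l l' => ?_)
  · exact isOpen_lt continuous_const ((continuous_apply _).comp continuous_subtype_val)
  · obtain ⟨v, hv⟩ : ∃ v, x.1 v ≠ 0 := by
      by_contra! h
      have := x.2.1.2
      simp [h] at this
    exact ⟨⟨v, mem_faces_of_subset x.2.2 (by simpa using hv) (Finset.singleton_nonempty _)⟩,
      lt_of_le_of_ne (x.2.1.1 v) hv.symm⟩
  · simpa [U] using isSimplyConnected_openStar i.2
  · rw [hne2] at h
    rw [hU2]
    exact (isSimplyConnected_openStar h).isPathConnected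
  · simp only [hne2, hne3] at *
    obtain ⟨l, h1, h2, h3⟩ := hcone _ _ _ hij hjk hik
    exact ⟨⟨l, mem_faces_of_subset h1 (by simp) (Finset.singleton_nonempty _)⟩, h1, h2, h3⟩
  · obtain ⟨l, h1, h2, h3⟩ := hnbr i j k i.2 j.2 k.2
    simp only [hne2]
    exact ⟨⟨l, vertex h1⟩, h1, h2, h3⟩
  · simp only [hne2]
    intro h1 h2 h3 h4
    have h := hconn i j (fun h => hij (Subtype.ext h)) l l' h1 h2 h3 h4
    suffices ∀ t, Relation.ReflTransGen (fun s t => {s, t} ∈ Y.faces ∧ {i.1, t} ∈ Y.faces ∧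
        {j.1, t} ∈ Y.faces) l.1 t → ∀ ht : {t} ∈ Y.faces, Relation.ReflTransGen
        (fun s t : {v : Fin n // {v} ∈ Y.faces} => {s.1, t.1} ∈ Y.faces ∧ {i.1, t.1} ∈ Y.faces ∧
          {j.1, t.1} ∈ Y.faces) l ⟨t, ht⟩ from this l' h l'.2
    intro t ht
    induction ht with
    | refl => exact fun _ => Relation.ReflTransGen.refl
    | @tail s t _ hst ih =>
      intro ht
      have hs : {s} ∈ Y.faces :=
        mem_faces_of_subset hst.1 (by simp) (Finset.singleton_nonempty _)
      exact (ih hs).tail hst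

end RandomComplex

/-! ### Independent coins -/

section Probability

open MeasureTheory ProbabilityTheory

theorem dependsOn_iInter {ι κ : Type*} [DecidableEq ι] {α : ι → Type*} {s : Finset κ}
    {K : κ → Finset ι} {A : κ → Set (Π i, α i)}
    (hA : ∀ k ∈ s, DependsOn (fun ω => ω ∈ A k) (K k : Set ι)) :
    DependsOn (fun ω => ω ∈ ⋂ k ∈ s, A k) (s.biUnion K : Set ι) := by
  intro x y hxy
  simp only [Set.mem_iInter, eq_iff_iff]
  refine forall₂_congr fun k hk => ?_
  exact iff_of_eq (hA k hk fun i hi => hxy i (by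
    simp only [Finset.coe_biUnion, Set.mem_iUnion]
    exact ⟨k, hk, hi⟩))

theorem dependsOn_compl {ι : Type*} {α : ι → Type*} {K : Set ι} {A : Set (Π i, α i)}
    (hA : DependsOn (fun ω => ω ∈ A) K) : DependsOn (fun ω => ω ∈ Aᶜ) K := by
  intro x y hxy
  have := hA hxy
  simp only [Set.mem_compl_iff] at *
  rw [this]

theorem dependsOn_eq_true {ι : Type*} (i : ι) :
    DependsOn (fun ω : ι → Bool => ω ∈ {ω | ω i = true}) ({i} : Set ι) := by
  intro x y h
  simp [h i rfl]

section Coins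

variable {ι : Type*} [Fintype ι]

/-- The law of independent coins indexed by `ι`, the coin `i` showing `true` with
probability `q i`. -/
noncomputable def coinMeasure (q : ι → unitInterval) : Measure (ι → Bool) :=
  Measure.pi fun i => bernoulliMeasure true false (q i)

instance (q : ι → unitInterval) : IsProbabilityMeasure (coinMeasure q) := by
  unfold coinMeasure
  infer_instance

theorem coinMeasure_real_pi (q : ι → unitInterval) (s : ι → Set Bool) :
    (coinMeasure q).real (Set.univ.pi s)
      = ∏ i, (bernoulliMeasure true false (q i)).real (s i) := by
  simp only [measureReal_def, coinMeasure, Measure.pi_pi, ENNReal.toReal_prod]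

theorem coinMeasure_real_eq_true (q : ι → unitInterval) (i : ι) :
    (coinMeasure q).real {ω | ω i = true} = q i := by
  classical
  have : {ω : ι → Bool | ω i = true}
      = Set.univ.pi fun j => if j = i then {true} else Set.univ := by
    ext ω
    simp only [Set.mem_ofPred_eq, Set.mem_pi, Set.mem_univ, true_implies]
    refine ⟨fun h j => ?_, fun h => by simpa using h i⟩
    split_ifs with hj
    · simpa [hj] using h
    · trivial
  rw [this, coinMeasure_real_pi, Finset.prod_eq_single i]
  · simp
  · intro j _ hj
    simp [hj]
  · simp

/-- Events depending on two disjoint sets of coins are independent. -/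
theorem coinMeasure_real_inter (q : ι → unitInterval) {S T : Finset ι} (hST : Disjoint S T)
    {A B : Set (ι → Bool)} (hA : DependsOn (fun ω => ω ∈ A) (S : Set ι))
    (hB : DependsOn (fun ω => ω ∈ B) (T : Set ι)) :
    (coinMeasure q).real (A ∩ B) = (coinMeasure q).real A * (coinMeasure q).real B := by
  have hind : iIndepFun (fun (i : ι) (ω : ι → Bool) => ω i) (coinMeasure q) :=
    iIndepFun_pi (X := fun _ b => b) fun i => aemeasurable_id
  have h2 := hind.indepFun_finset S T hST fun i => measurable_pi_apply i
  have pre : ∀ (R : Finset ι) (D : Set (ι → Bool)), DependsOn (fun ω => ω ∈ D) (R : Set ι) →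
      D = (fun (ω : ι → Bool) (i : R) => ω i) ⁻¹' ((fun (ω : ι → Bool) (i : R) => ω i) '' D) := by
    intro R D hD
    refine (Set.subset_preimage_image _ _).antisymm ?_
    rintro ω ⟨ω', hω', he⟩
    have := hD (x := ω') (y := ω) fun i hi => congrFun he ⟨i, hi⟩
    exact (iff_of_eq this).1 hω'
  rw [pre S A hA, pre T B hB, measureReal_def, measureReal_def, measureReal_def,
    h2.measure_inter_preimage_eq_mul _ _ (Set.toFinite _).measurableSet
      (Set.toFinite _).measurableSet, ENNReal.toReal_mul]

/-- Events depending on pairwise disjoint sets of coins are independent. -/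
theorem coinMeasure_real_iInter [DecidableEq ι] (q : ι → unitInterval) {κ : Type*} (s : Finset κ)
    {K : κ → Finset ι} (hK : (s : Set κ).PairwiseDisjoint K) {A : κ → Set (ι → Bool)}
    (hA : ∀ k ∈ s, DependsOn (fun ω => ω ∈ A k) (K k : Set ι)) :
    (coinMeasure q).real (⋂ k ∈ s, A k) = ∏ k ∈ s, (coinMeasure q).real (A k) := by
  classical
  induction s using Finset.induction_on with
  | empty => simp
  | insert a s ha ih =>
    rw [Finset.prod_insert ha, Finset.set_biInter_insert, ← ih
      (hK.subset (by simp)) fun k hk => hA k (Finset.mem_insert_of_mem hk)]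
    refine coinMeasure_real_inter q (T := s.biUnion K) ?_ (hA a (Finset.mem_insert_self a s))
      (dependsOn_iInter fun k hk => hA k (Finset.mem_insert_of_mem hk))
    rw [Finset.disjoint_biUnion_right]
    intro k hk
    exact hK (by simp) (by simp [hk]) (fun h => ha (h ▸ hk))

theorem coinMeasure_real_compl (q : ι → unitInterval) (A : Set (ι → Bool)) :
    (coinMeasure q).real Aᶜ = 1 - (coinMeasure q).real A :=
  probReal_compl_eq_one_sub (Set.toFinite _).measurableSet

/-- The probability that all coins of a finite set show `true`. -/
theorem coinMeasure_real_forall [DecidableEq ι] (q : ι → unitInterval) (s : Finset ι) :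
    (coinMeasure q).real {ω | ∀ i ∈ s, ω i = true} = ∏ i ∈ s, (q i : ℝ) := by
  have : {ω : ι → Bool | ∀ i ∈ s, ω i = true} = ⋂ i ∈ s, {ω | ω i = true} := by
    ext ω
    simp
  rw [this, coinMeasure_real_iInter q s (K := fun i => {i})]
  · simp only [coinMeasure_real_eq_true]
  · intro i _ j _ hij
    simpa using hij
  · intro i _
    simpa using dependsOn_eq_true i

/-- The probability that some coin of a finite set shows `true`. -/
theorem coinMeasure_real_exists [DecidableEq ι] (q : ι → unitInterval) (s : Finset ι) :
    (coinMeasure q).real {ω | ∃ i ∈ s, ω i = true} = 1 - ∏ i ∈ s, (1 - (q i : ℝ)) := by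
  have : {ω : ι → Bool | ∃ i ∈ s, ω i = true} = (⋂ i ∈ s, {ω | ω i = true}ᶜ)ᶜ := by
    ext ω
    simp
  rw [this, coinMeasure_real_compl, coinMeasure_real_iInter q s (K := fun i => {i})]
  · simp only [coinMeasure_real_compl, coinMeasure_real_eq_true]
  · intro i _ j _ hij
    simpa using hij
  · intro i _
    simpa using dependsOn_compl (dependsOn_eq_true i)

/-- If many independent events each have probability at least `a`, it is unlikely that none of them
occurs. -/
theorem coinMeasure_real_forall_not_le [DecidableEq ι] (q : ι → unitInterval) {κ : Type*}
    (s : Finset κ) {K : κ → Finset ι} (hK : (s : Set κ).PairwiseDisjoint K)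
    {A : κ → Set (ι → Bool)} (hA : ∀ k ∈ s, DependsOn (fun ω => ω ∈ A k) (K k : Set ι)) {a : ℝ}
    (ha : ∀ k ∈ s, a ≤ (coinMeasure q).real (A k)) :
    (coinMeasure q).real {ω | ∀ k ∈ s, ω ∉ A k} ≤ Real.exp (-(s.card * a)) := by
  have : {ω : ι → Bool | ∀ k ∈ s, ω ∉ A k} = ⋂ k ∈ s, (A k)ᶜ := by
    ext ω
    simp
  rw [this, coinMeasure_real_iInter q s hK fun k hk => dependsOn_compl (hA k hk)]
  calc ∏ k ∈ s, (coinMeasure q).real (A k)ᶜ ≤ ∏ _k ∈ s, Real.exp (-a) := by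
        refine Finset.prod_le_prod (fun _ _ => measureReal_nonneg) fun k hk => ?_
        rw [coinMeasure_real_compl]
        have := Real.add_one_le_exp (-a)
        linarith [ha k hk]
    _ = Real.exp (-(s.card * a)) := by
        rw [Finset.prod_const, ← Real.exp_nat_mul]
        congr 1
        ring

end Coins

namespace RandomComplex

/-! ### The random complex as a function of independent coins -/

/-- The complex produced by coins: a simplex of dimension at most `r` is a face when the coins of
all its nonempty faces show `true`. -/
def ofCoins {n : ℕ} (r : ℕ) (ω : Finset (Fin n) → Bool) : Omega n r :=
  ⟨{ faces := {σ | σ.Nonempty ∧ σ.card ≤ r + 1 ∧ ∀ τ ⊆ σ, τ.Nonempty → ω τ = true}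
     isRelLowerSet_faces := fun _ hσ => ⟨hσ.1, fun _ hτσ hτ =>
      ⟨hτ, (Finset.card_le_card hτσ).trans hσ.2.1, fun ρ hρ => hσ.2.2 ρ (hρ.trans hτσ)⟩⟩ },
    fun _ hσ => hσ.2.1⟩

/-- The external faces of a complex, of dimension at most `r`. -/
def externalFaces {n r : ℕ} (Y : Omega n r) : Set (Finset (Fin n)) :=
  {σ | σ.Nonempty ∧ σ.card ≤ r + 1 ∧ σ ∉ Y.1.faces ∧
    ∀ τ : Finset (Fin n), τ ⊂ σ → τ.Nonempty → τ ∈ Y.1.faces}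

/-- The coins that produce `Y` show `true` at its faces, `false` at its external faces, and are
arbitrary elsewhere. -/
theorem ofCoins_eq_iff {n r : ℕ} (Y : Omega n r) (ω : Finset (Fin n) → Bool) :
    ofCoins r ω = Y ↔
      (∀ σ ∈ Y.1.faces, ω σ = true) ∧ ∀ σ ∈ externalFaces Y, ω σ = false := by
  constructor
  · rintro rfl
    refine ⟨fun σ hσ => hσ.2.2 σ subset_rfl hσ.1, fun σ hσ => ?_⟩
    by_contra h
    rw [Bool.not_eq_false] at h
    refine hσ.2.2.1 ⟨hσ.1, hσ.2.1, fun τ hτ hne => ?_⟩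
    rcases hτ.eq_or_ssubset with rfl | hss
    · exact h
    · exact (hσ.2.2.2 τ hss hne).2.2 τ subset_rfl hne
  · rintro ⟨h1, h2⟩
    refine Subtype.ext (PreAbstractSimplicialComplex.ext (Set.ext fun σ => ?_))
    constructor
    · intro hσ
      have key : ∀ τ : Finset (Fin n), τ ⊆ σ → τ.Nonempty → τ ∈ Y.1.faces := by
        intro τ
        induction τ using Finset.strongInduction with
        | H τ ih =>
          intro hτ hne
          by_contra hn
          have := h2 τ ⟨hne, (Finset.card_le_card hτ).trans hσ.2.1, hn,
            fun ρ hρ hρne => ih ρ hρ (hρ.subset.trans hτ) hρne⟩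
          rw [hσ.2.2 τ hτ hne] at this
          cases this
      exact key σ subset_rfl hσ.1
    · intro hσ
      exact ⟨(Y.1.isRelLowerSet_faces hσ).1, Y.2 σ hσ, fun τ hτ hne =>
        h1 τ ((Y.1.isRelLowerSet_faces hσ).2 hτ hne)⟩

/-- The probability of the coin of a simplex; coins which no complex in `Omega n r` uses get an
irrelevant value. -/
def coinProb (n : ℕ) {r : ℕ} (p : Fin (r + 1) → unitInterval) (σ : Finset (Fin n)) :
    unitInterval :=
  if h : σ.card - 1 < r + 1 then p ⟨σ.card - 1, h⟩ else 0

/-- A product over dimensions with face numbers as exponents is a product over the faces. -/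
theorem prod_pow_ncard_eq_prod {n r : ℕ} (g : Fin (r + 1) → ℝ) (S : Finset (Finset (Fin n)))
    (hS : ∀ σ ∈ S, σ.Nonempty ∧ σ.card ≤ r + 1) (F : Finset (Fin n) → ℝ)
    (hF : ∀ σ ∈ S, ∀ i : Fin (r + 1), σ.card = i + 1 → F σ = g i) :
    ∏ i : Fin (r + 1), g i ^ {σ : Finset (Fin n) | σ.card = i + 1 ∧ σ ∈ S}.ncard
      = ∏ σ ∈ S, F σ := by
  classical
  have hmap : ∀ σ ∈ S, σ.card - 1 < r + 1 := fun σ hσ => by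
    have := (hS σ hσ).2
    omega
  rw [← Finset.prod_fiberwise_of_maps_to
    (g := fun σ : Finset (Fin n) => Fin.ofNat (r + 1) (σ.card - 1)) (t := Finset.univ)
    (fun _ _ => Finset.mem_univ _)]
  refine Finset.prod_congr rfl fun i _ => ?_
  have hiff : ∀ σ ∈ S, (Fin.ofNat (r + 1) (σ.card - 1) = i ↔ σ.card = i + 1) := by
    intro σ hσ
    have h1 := (hS σ hσ).1.card_pos
    rw [Fin.ext_iff, Fin.val_ofNat, Nat.mod_eq_of_lt (hmap σ hσ)]
    omega
  have hset : {σ : Finset (Fin n) | σ.card = i + 1 ∧ σ ∈ S}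
      = (S.filter fun σ => Fin.ofNat (r + 1) (σ.card - 1) = i : Finset (Finset (Fin n))) := by
    ext σ
    simp only [Set.mem_ofPred_eq, Finset.coe_filter]
    constructor
    · rintro ⟨h, hσ⟩
      exact ⟨hσ, (hiff σ hσ).2 h⟩
    · rintro ⟨hσ, h⟩
      exact ⟨(hiff σ hσ).1 h, hσ⟩
  rw [hset, Set.ncard_coe_finset, ← Finset.prod_const]
  refine Finset.prod_congr rfl fun σ hσ => ?_
  rw [Finset.mem_filter] at hσ
  exact (hF σ hσ.1 i ((hiff σ hσ.1).1 hσ.2)).symm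

/-- The coins that produce `Y` form a box, whose measure is the weight of `Y`. -/
theorem coinMeasure_real_ofCoins_eq {n r : ℕ} (p : Fin (r + 1) → unitInterval) (Y : Omega n r) :
    (coinMeasure (coinProb n p)).real {ω | ofCoins r ω = Y} = weight (fun i => (p i : ℝ)) Y := by
  classical
  have hset : {ω | ofCoins r ω = Y} = Set.univ.pi fun σ : Finset (Fin n) =>
      if σ ∈ Y.1.faces then {true} else if σ ∈ externalFaces Y then {false} else Set.univ := by
    ext ω
    simp only [Set.mem_ofPred_eq, ofCoins_eq_iff, Set.mem_pi, Set.mem_univ, true_implies]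
    constructor
    · rintro ⟨h1, h2⟩ σ
      split_ifs with hf he
      · exact h1 σ hf
      · exact h2 σ he
      · trivial
    · intro h
      refine ⟨fun σ hσ => by simpa [hσ] using h σ, fun σ hσ => ?_⟩
      have hn : σ ∉ Y.1.faces := hσ.2.2.1
      simpa [hσ, hn] using h σ
  have hprod : ∀ σ : Finset (Fin n), (bernoulliMeasure true false (coinProb n p σ)).real
      (if σ ∈ Y.1.faces then {true} else if σ ∈ externalFaces Y then {false} else Set.univ)
      = (if σ ∈ Y.1.faces then (coinProb n p σ : ℝ) else 1) *
        if σ ∈ externalFaces Y then 1 - (coinProb n p σ : ℝ) else 1 := by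
    intro σ
    by_cases hf : σ ∈ Y.1.faces
    · have he : σ ∉ externalFaces Y := fun h => h.2.2.1 hf
      simp [hf, he]
    · by_cases he : σ ∈ externalFaces Y
      · simp [hf, he]
      · simp [hf, he]
  have hcoin : ∀ (σ : Finset (Fin n)) (i : Fin (r + 1)), σ.card = i + 1 →
      coinProb n p σ = p i := by
    intro σ i h
    have : σ.card - 1 = i := by omega
    have hi : σ.card - 1 < r + 1 := this ▸ i.2
    rw [coinProb, dif_pos hi]
    exact congrArg p (Fin.ext this)
  rw [hset, coinMeasure_real_pi, Finset.prod_congr rfl fun σ _ => hprod σ, Finset.prod_mul_distrib,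
    ← Finset.prod_filter, ← Finset.prod_filter, weight]
  congr 1
  · rw [← prod_pow_ncard_eq_prod (r := r) (fun i => (p i : ℝ))]
    · simp [numFaces]
    · intro σ hσ
      rw [Finset.mem_filter] at hσ
      exact ⟨(Y.1.isRelLowerSet_faces hσ.2).1, Y.2 σ hσ.2⟩
    · intro σ _ i hi
      rw [hcoin σ i hi]
  · rw [← prod_pow_ncard_eq_prod (r := r) (fun i => 1 - (p i : ℝ))]
    · refine Finset.prod_congr rfl fun i _ => congrArg (fun m => (1 - (p i : ℝ)) ^ m)
        (congrArg Set.ncard (Set.ext fun σ => and_congr_right fun hc => ?_))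
      rw [Finset.mem_filter]
      exact ⟨fun h => h.2.2.2, fun h => ⟨Finset.mem_univ σ, Finset.card_pos.1 (by omega),
        by have := i.2; omega, h⟩⟩
    · intro σ hσ
      rw [Finset.mem_filter] at hσ
      exact ⟨hσ.2.1, hσ.2.2.1⟩
    · intro σ _ i hi
      rw [hcoin σ i hi]

/-- The multiparameter random complex is the complex produced by independent coins. -/
theorem prob_eq_coinMeasure_real {n r : ℕ} (p : Fin (r + 1) → unitInterval)
    (E : Set (Omega n r)) :
    prob (fun i => (p i : ℝ)) E = (coinMeasure (coinProb n p)).real {ω | ofCoins r ω ∈ E} := by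
  classical
  have hset : {ω : Finset (Fin n) → Bool | ofCoins r ω ∈ E}
      = ⋃ Y ∈ Finset.univ.filter (· ∈ E), {ω | ofCoins r ω = Y} := by
    ext ω
    simp
  rw [hset, measureReal_biUnion_finset, prob]
  · exact Finset.sum_congr (by ext; simp) fun Y _ => (coinMeasure_real_ofCoins_eq p Y).symm
  · intro Y _ Z _ hYZ
    rw [Function.onFun, Set.disjoint_left]
    rintro ω rfl h
    exact hYZ h
  · exact fun Y _ => (Set.toFinite _).measurableSet

/-! ### Cones and common neighbours -/

/-- Some vertex `w` outside the sets `F k` is present and is joined to every one of them, as far as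
the coins of vertices and edges are concerned. -/
def Hits {n : ℕ} {κ : Type*} (F : κ → Finset (Fin n)) (ω : Finset (Fin n) → Bool) : Prop :=
  ∃ w, (∀ k, w ∉ F k) ∧ ω {w} = true ∧ ∀ k, ∃ s ∈ F k, ω {s, w} = true

/-- Some vertex `w` outside `T` is the apex of a cone over the graph spanned by `T`, as far as the
coins of simplices containing `w` are concerned. -/
def HasCone {n : ℕ} (T : Finset (Fin n)) (ω : Finset (Fin n) → Bool) : Prop :=
  ∃ w, w ∉ T ∧ ∀ τ ⊆ T, τ.card ≤ 2 → ω (insert w τ) = true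

theorem singleton_mem_ofCoins_iff {n r : ℕ} {ω : Finset (Fin n) → Bool} {v : Fin n} :
    {v} ∈ (ofCoins r ω).1.faces ↔ ω {v} = true := by
  refine ⟨fun h => h.2.2 _ subset_rfl h.1, fun h => ⟨Finset.singleton_nonempty v, by simp, ?_⟩⟩
  intro τ hτ hne
  rwa [hne.subset_singleton_iff.1 hτ]

theorem insert_mem_ofCoins {n r : ℕ} {ω : Finset (Fin n) → Bool} {w : Fin n}
    {σ : Finset (Fin n)} (hσ : σ ∈ (ofCoins r ω).1.faces) (hr : σ.card ≤ r)
    (hw : ∀ τ ⊆ σ, ω (insert w τ) = true) : insert w σ ∈ (ofCoins r ω).1.faces := by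
  refine ⟨Finset.insert_nonempty _ _, (Finset.card_insert_le _ _).trans (by omega), ?_⟩
  intro τ hτ hne
  by_cases h : w ∈ τ
  · rw [← Finset.insert_erase h]
    exact hw _ (Finset.subset_insert_iff.1 hτ)
  · exact hσ.2.2 τ ((Finset.subset_insert_iff_of_notMem h).1 hτ) hne

theorem pair_mem_ofCoins {n r : ℕ} {ω : Finset (Fin n) → Bool} {s w : Fin n} (hr : 1 ≤ r)
    (hs : {s} ∈ (ofCoins r ω).1.faces) (hw : ω {w} = true) (hsw : ω {s, w} = true) :
    {s, w} ∈ (ofCoins r ω).1.faces := by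
  rw [Finset.pair_comm]
  refine insert_mem_ofCoins hs (by simpa using hr) fun τ hτ => ?_
  rcases Finset.subset_singleton_iff.1 hτ with rfl | rfl
  · simpa using hw
  · rwa [Finset.pair_comm]

/-- If every set of at most three vertices has a cone, small sets of common neighbours of two
vertices have a further neighbour among the common neighbours, and any two such sets of size `t` are
both joined to one common neighbour, then the complex is simply connected: a component of the graph
of common neighbours has at least `t` elements, and two components of that size are joined. -/
theorem simplyConnectedSpace_ofCoins {n r : ℕ} (hr : 2 ≤ r) {ω : Finset (Fin n) → Bool} (t : ℕ)
    (hcone : ∀ T : Finset (Fin n), T.card ≤ 3 → HasCone T ω)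
    (hgrow : ∀ u v S, u ≠ v → u ∉ S → v ∉ S → S.Nonempty → S.card ≤ t → Hits ![{u}, {v}, S] ω)
    (hjoin : ∀ u v S S', u ≠ v → u ∉ S → v ∉ S → u ∉ S' → v ∉ S' → Disjoint S S' →
      S.card = t → S'.card = t → Hits ![{u}, {v}, S, S'] ω) :
    SimplyConnectedSpace (realization (ofCoins r ω).1) := by
  classical
  set Y := (ofCoins r ω).1 with hY
  have vertex : ∀ {a l : Fin n}, {a, l} ∈ Y.faces → {l} ∈ Y.faces := fun h =>
    mem_faces_of_subset h (by simp) (Finset.singleton_nonempty _)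
  have hcone' : ∀ T : Finset (Fin n), T.card ≤ 3 → ∃ w, ∀ σ ⊆ T, σ.card ≤ 2 → σ ∈ Y.faces →
      insert w σ ∈ Y.faces := by
    intro T hT
    obtain ⟨w, -, hw⟩ := hcone T hT
    exact ⟨w, fun σ hσ hc hσY => insert_mem_ofCoins hσY (hc.trans hr) fun τ hτ =>
      hw τ (hτ.trans hσ) ((Finset.card_le_card hτ).trans hc)⟩
  refine simplyConnectedSpace_realization ?_ (fun a b c ha hb hc => ?_)
    (fun a b c hab hbc hac => ?_) (fun a b hab l l' hal hbl hal' hbl' => ?_)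
  · obtain ⟨w, -, hw⟩ := hcone ∅ (by simp)
    exact ⟨w, singleton_mem_ofCoins_iff.2 (by simpa using hw ∅ subset_rfl (by simp))⟩
  · obtain ⟨w, hw⟩ := hcone' {a, b, c} Finset.card_le_three
    refine ⟨w, ?_, ?_, ?_⟩ <;> rw [Finset.pair_comm] <;>
      exact hw _ (by simp) (by simp) (by assumption)
  · obtain ⟨w, hw⟩ := hcone' {a, b, c} Finset.card_le_three
    have rot : ∀ x y : Fin n, ({x, y, w} : Finset (Fin n)) = insert w {x, y} := by
      intro x y
      ext z
      simp only [Finset.mem_insert, Finset.mem_singleton]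
      tauto
    refine ⟨w, ?_⟩
    rw [rot, rot, rot]
    exact ⟨hw _ (by grind) Finset.card_le_two hab, hw _ (by grind) Finset.card_le_two hbc,
      hw _ (by grind) Finset.card_le_two hac⟩
  · -- `N` is the set of common neighbours of `a` and `b` other than these two
    let N : Fin n → Prop := fun x => x ≠ a ∧ x ≠ b ∧ {a, x} ∈ Y.faces ∧ {b, x} ∈ Y.faces
    let R : Fin n → Fin n → Prop := fun s t => {s, t} ∈ Y.faces ∧ N s ∧ N t
    by_cases hla : l = a
    · subst hla
      exact .single ⟨hal', hal', hbl'⟩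
    by_cases hlb : l = b
    · subst hlb
      exact .single ⟨hbl', hal', hbl'⟩
    by_cases hla' : l' = a
    · subst hla'
      exact .single ⟨by rwa [Finset.pair_comm], hal', hbl'⟩
    by_cases hlb' : l' = b
    · subst hlb'
      exact .single ⟨by rwa [Finset.pair_comm], hal', hbl'⟩
    have hNl : N l := ⟨hla, hlb, hal, hbl⟩
    have hNl' : N l' := ⟨hla', hlb', hal', hbl'⟩
    suffices h : Relation.ReflTransGen R l l' from
      Relation.ReflTransGen.mono (fun s t hst => ⟨hst.1, hst.2.2.2.2⟩) _ _ h
    have : Std.Symm R := ⟨fun s t hst =>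
      ⟨by rw [Finset.pair_comm]; exact hst.1, hst.2.2, hst.2.1⟩⟩
    have hsymm : ∀ {s t}, Relation.ReflTransGen R s t → Relation.ReflTransGen R t s :=
      fun h => Relation.ReflTransGen.stdSymm.symm _ _ h
    let comp : Fin n → Finset (Fin n) := fun x => Finset.univ.filter (Relation.ReflTransGen R x)
    have mem_comp : ∀ x y, y ∈ comp x ↔ Relation.ReflTransGen R x y := fun x y => by simp [comp]
    have comp_N : ∀ x, N x → ∀ y ∈ comp x, N y := by
      intro x hx y hy
      rw [mem_comp] at hy
      cases hy with
      | refl => exact hx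
      | tail _ h => exact h.2.2
    have hNw : ∀ w, w ≠ a → w ≠ b → ω {w} = true → ω {a, w} = true → ω {b, w} = true → N w :=
      fun w h1 h2 h3 h4 h5 => ⟨h1, h2,
        pair_mem_ofCoins (by omega) (mem_faces_of_subset hal (by simp) (by simp)) h3 h4,
        pair_mem_ofCoins (by omega) (mem_faces_of_subset hbl (by simp) (by simp)) h3 h5⟩
    have hR : ∀ s w, N s → N w → ω {s, w} = true → R s w := fun s w hs hw h =>
      ⟨pair_mem_ofCoins (by omega) (vertex hs.2.2.1)
        (singleton_mem_ofCoins_iff.1 (vertex hw.2.2.1)) h, hs, hw⟩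
    have comp_card : ∀ x, N x → t ≤ (comp x).card := by
      intro x hx
      by_contra! hlt
      obtain ⟨w, hw, hww, hwj⟩ := hgrow a b (comp x) hab (fun h => (comp_N x hx a h).1 rfl)
        (fun h => (comp_N x hx b h).2.1 rfl) ⟨x, (mem_comp x x).2 .refl⟩ hlt.le
      have hw0 := hw 0
      have hw1 := hw 1
      have hw2 := hw 2
      have hj0 := hwj 0
      have hj1 := hwj 1
      have hj2 := hwj 2
      simp only [Matrix.cons_val, Finset.mem_singleton, exists_eq_left] at hw0 hw1 hw2 hj0 hj1 hj2
      obtain ⟨s, hs, hsw⟩ := hj2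
      have hN := hNw w hw0 hw1 hww hj0 hj1
      exact hw2 ((mem_comp x w).2 (((mem_comp x s).1 hs).tail (hR s w (comp_N x hx s hs) hN hsw)))
    obtain ⟨S, hSl, hS⟩ := Finset.exists_subset_card_eq (comp_card l hNl)
    obtain ⟨S', hSl', hS'⟩ := Finset.exists_subset_card_eq (comp_card l' hNl')
    by_contra hn
    have hdisj : Disjoint S S' := by
      rw [Finset.disjoint_left]
      intro x hx hx'
      exact hn (((mem_comp l x).1 (hSl hx)).trans (hsymm ((mem_comp l' x).1 (hSl' hx'))))
    obtain ⟨w, hw, hww, hwj⟩ := hjoin a b S S' hab (fun h => (comp_N l hNl a (hSl h)).1 rfl)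
      (fun h => (comp_N l hNl b (hSl h)).2.1 rfl) (fun h => (comp_N l' hNl' a (hSl' h)).1 rfl)
      (fun h => (comp_N l' hNl' b (hSl' h)).2.1 rfl) hdisj hS hS'
    have hw0 := hw 0
    have hw1 := hw 1
    have hj0 := hwj 0
    have hj1 := hwj 1
    have hj2 := hwj 2
    have hj3 := hwj 3
    simp only [Matrix.cons_val, Finset.mem_singleton, exists_eq_left] at hw0 hw1 hj0 hj1 hj2 hj3
    obtain ⟨s, hs, hsw⟩ := hj2
    obtain ⟨s', hs', hsw'⟩ := hj3
    have hN := hNw w hw0 hw1 hww hj0 hj1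
    have h1 := ((mem_comp l s).1 (hSl hs)).tail (hR s w (comp_N l hNl s (hSl hs)) hN hsw)
    have h2 := ((mem_comp l' s').1 (hSl' hs')).tail
      (hR s' w (comp_N l' hNl' s' (hSl' hs')) hN hsw')
    exact hn (h1.trans (hsymm h2))

/-! ### Probability of missing common neighbours -/

section MissingNeighbours

theorem pair_left_injOn {n : ℕ} {w : Fin n} {S : Finset (Fin n)} (hw : w ∉ S) :
    Set.InjOn (fun s => ({s, w} : Finset (Fin n))) (S : Set (Fin n)) := by
  intro s hs s' hs' h
  have h' : ({s, w} : Finset (Fin n)) = {s', w} := h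
  have hmem : s ∈ ({s', w} : Finset (Fin n)) := h' ▸ Finset.mem_insert_self s {w}
  rw [Finset.mem_insert, Finset.mem_singleton] at hmem
  exact hmem.resolve_right fun hsw => hw (hsw ▸ hs)

theorem dependsOn_exists {ι : Type*} (S : Finset ι) :
    DependsOn (fun ω : ι → Bool => ω ∈ {ω : ι → Bool | ∃ i ∈ S, ω i = true}) (S : Set ι) := by
  intro x y h
  simp only [Set.mem_ofPred_eq, eq_iff_iff]
  exact exists_congr fun i => and_congr_right fun hi => by rw [h i hi]

variable {n : ℕ} {q : Finset (Fin n) → unitInterval} {p₀ p₁ p₂ : ℝ}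

/-- The probability that a fixed vertex is present and joined to each of some disjoint sets. -/
theorem coinMeasure_real_joined {κ : Type*} [Fintype κ] (h₀ : ∀ σ, σ.card = 1 → (q σ : ℝ) = p₀)
    (h₁ : ∀ σ, σ.card = 2 → (q σ : ℝ) = p₁) {F : κ → Finset (Fin n)}
    (hF : Pairwise fun k l => Disjoint (F k) (F l)) {w : Fin n} (hw : ∀ k, w ∉ F k) :
    (coinMeasure q).real {ω | ω {w} = true ∧ ∀ k, ∃ s ∈ F k, ω {s, w} = true}
      = p₀ * ∏ k, (1 - (1 - p₁) ^ (F k).card) := by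
  classical
  let J : κ → Finset (Finset (Fin n)) := fun k => (F k).image fun s => {s, w}
  have hset : {ω : Finset (Fin n) → Bool | ω {w} = true ∧ ∀ k, ∃ s ∈ F k, ω {s, w} = true}
      = {ω | ω {w} = true} ∩
        ⋂ k ∈ (Finset.univ : Finset κ), {ω : Finset (Fin n) → Bool | ∃ i ∈ J k, ω i = true} := by
    ext ω
    simp [J]
  have hsw : ∀ k, ∀ s ∈ F k, s ≠ w := fun k s hs h => hw k (h ▸ hs)
  rw [hset, coinMeasure_real_inter q (S := {{w}}) (T := Finset.univ.biUnion J)]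
  · rw [coinMeasure_real_eq_true, h₀ _ (by simp), coinMeasure_real_iInter q _ (K := J)]
    · congr 1
      refine Finset.prod_congr rfl fun k _ => ?_
      rw [coinMeasure_real_exists, Finset.prod_image (pair_left_injOn (hw k)),
        ← Finset.prod_const]
      congr 1
      refine Finset.prod_congr rfl fun s hs => ?_
      rw [h₁ _ (Finset.card_pair (hsw k s hs))]
    · intro k _ l _ hkl
      rw [Function.onFun, Finset.disjoint_left]
      intro σ hk hl
      simp only [J, Finset.mem_image] at hk hl
      obtain ⟨s, hs, rfl⟩ := hk
      obtain ⟨s', hs', h⟩ := hl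
      have hmem : s' ∈ ({s, w} : Finset (Fin n)) := h ▸ Finset.mem_insert_self s' {w}
      rw [Finset.mem_insert, Finset.mem_singleton] at hmem
      obtain rfl := hmem.resolve_right (hsw l s' hs')
      exact Finset.disjoint_left.1 (hF hkl) hs hs'
    · exact fun k _ => dependsOn_exists (J k)
  · rw [Finset.disjoint_singleton_left]
    simp only [J, Finset.mem_biUnion, Finset.mem_image, not_exists, not_and]
    intro k _ s hs h
    have := Finset.card_pair (hsw k s hs)
    rw [h] at this
    simp at this
  · simpa using dependsOn_eq_true ({w} : Finset (Fin n))
  · exact dependsOn_iInter fun k _ => dependsOn_exists (J k)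

/-- The events that `w` is joined to the given sets, for different `w`, use different coins. -/
theorem coinMeasure_real_not_hits_le {κ : Type*} [Fintype κ]
    (h₀ : ∀ σ, σ.card = 1 → (q σ : ℝ) = p₀) (h₁ : ∀ σ, σ.card = 2 → (q σ : ℝ) = p₁)
    {F : κ → Finset (Fin n)} (hF : Pairwise fun k l => Disjoint (F k) (F l)) {a b : ℝ}
    (ha : 0 ≤ a) (hab : a ≤ p₀ * ∏ k, (1 - (1 - p₁) ^ (F k).card))
    (hb : b + ∑ k, ((F k).card : ℝ) ≤ n) :
    (coinMeasure q).real {ω | ¬ Hits F ω} ≤ Real.exp (-(b * a)) := by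
  classical
  let s : Finset (Fin n) := Finset.univ \ Finset.univ.biUnion F
  have hs : ∀ w ∈ s, ∀ k, w ∉ F k := by
    intro w hw k hk
    simp only [s, Finset.mem_sdiff, Finset.mem_univ, true_and, Finset.mem_biUnion,
      not_exists] at hw
    exact hw k hk
  have hset : {ω | ¬ Hits F ω} ⊆ {ω : Finset (Fin n) → Bool | ∀ w ∈ s,
      ω ∉ {ω : Finset (Fin n) → Bool | ω {w} = true ∧ ∀ k, ∃ s ∈ F k, ω {s, w} = true}} :=
    fun ω hω w hw h => hω ⟨w, hs w hw, h⟩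
  let K : Fin n → Finset (Finset (Fin n)) := fun w =>
    insert {w} ((Finset.univ.biUnion F).image fun s => {s, w})
  have hKmem : ∀ w ∈ s, ∀ σ ∈ K w, ∀ w' ∈ s, w' ∈ σ → w' = w := by
    intro w _ σ hσ w' hw' hmem
    simp only [K, Finset.mem_insert, Finset.mem_image, Finset.mem_biUnion, Finset.mem_univ,
      true_and] at hσ
    rcases hσ with rfl | ⟨v, ⟨k, hv⟩, rfl⟩
    · simpa using hmem
    · rw [Finset.mem_insert, Finset.mem_singleton] at hmem
      exact hmem.resolve_left fun h => hs w' hw' k (h ▸ hv)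
  have hself : ∀ w, ∀ σ ∈ K w, w ∈ σ := by
    intro w σ hσ
    simp only [K, Finset.mem_insert, Finset.mem_image] at hσ
    rcases hσ with rfl | ⟨v, -, rfl⟩ <;> simp
  refine (measureReal_mono hset).trans ((coinMeasure_real_forall_not_le q s (K := K) (a := a)
    ?_ ?_ ?_).trans (Real.exp_le_exp.2 (neg_le_neg (mul_le_mul_of_nonneg_right ?_ ha))))
  · intro w hw w' hw' hww'
    rw [Function.onFun, Finset.disjoint_left]
    intro σ hσ hσ'
    exact hww' (hKmem w' hw' σ hσ' w hw (hself w σ hσ))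
  · intro w _ x y hxy
    have hxw : x {w} = y {w} := hxy _ (by simp [K])
    have hxs : ∀ k, ∀ s ∈ F k, x {s, w} = y {s, w} := by
      intro k s hs
      refine hxy _ ?_
      simp only [K, Finset.coe_insert, Set.mem_insert_iff, Finset.mem_coe, Finset.mem_image,
        Finset.mem_biUnion]
      exact Or.inr ⟨s, ⟨k, Finset.mem_univ k, hs⟩, rfl⟩
    simp only [Set.mem_ofPred_eq, eq_iff_iff, hxw]
    exact and_congr_right fun _ => forall_congr' fun k => exists_congr fun v =>
      and_congr_right fun hv => by rw [hxs k v hv]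
  · intro w hw
    rwa [coinMeasure_real_joined h₀ h₁ hF (hs w hw)]
  · have h2 : (Finset.univ.biUnion F).card ≤ ∑ k, (F k).card := Finset.card_biUnion_le
    have h3 : n ≤ s.card + (Finset.univ.biUnion F).card := by
      have := Finset.card_sdiff_add_card_eq_card (Finset.subset_univ (Finset.univ.biUnion F))
      rw [Finset.card_univ, Fintype.card_fin] at this
      exact this.ge
    have h4 : (n : ℝ) ≤ s.card + ∑ k, ((F k).card : ℝ) := by exact_mod_cast h3.trans (by omega)
    linarith

/-- The events that `w` is the apex of a cone over `T`, for different `w`, use different coins, and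
each has probability at least `p₀ p₁³ p₂³`. -/
theorem coinMeasure_real_not_hasCone_le (h₀ : ∀ σ, σ.card = 1 → (q σ : ℝ) = p₀)
    (h₁ : ∀ σ, σ.card = 2 → (q σ : ℝ) = p₁) (h₂ : ∀ σ, σ.card = 3 → (q σ : ℝ) = p₂)
    (hp₀ : 0 ≤ p₀) (hp₁ : 0 ≤ p₁) (hp₁' : p₁ ≤ 1) (hp₂ : 0 ≤ p₂) (hp₂' : p₂ ≤ 1)
    {T : Finset (Fin n)} (hT : T.card ≤ 3) :
    (coinMeasure q).real {ω | ¬ HasCone T ω}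
      ≤ Real.exp (-((n - 3) * (p₀ * p₁ ^ 3 * p₂ ^ 3))) := by
  classical
  let P : Finset (Finset (Fin n)) := T.powerset.filter fun τ => τ.card ≤ 2
  have hP : ∀ τ, τ ∈ P ↔ τ ⊆ T ∧ τ.card ≤ 2 := fun τ => by simp [P]
  let K : Fin n → Finset (Finset (Fin n)) := fun w => P.image fun τ => insert w τ
  have hset : {ω | ¬ HasCone T ω} ⊆ {ω : Finset (Fin n) → Bool | ∀ w ∈ Finset.univ \ T,
      ω ∉ {ω : Finset (Fin n) → Bool | ∀ i ∈ K w, ω i = true}} := by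
    intro ω hω w hw h
    refine hω ⟨w, by simpa using hw, fun τ hτ hc => h _ ?_⟩
    exact Finset.mem_image_of_mem _ ((hP τ).2 ⟨hτ, hc⟩)
  have ha : 0 ≤ p₀ * p₁ ^ 3 * p₂ ^ 3 := by positivity
  refine (measureReal_mono hset).trans ((coinMeasure_real_forall_not_le q _ (K := K)
    (a := p₀ * p₁ ^ 3 * p₂ ^ 3) ?_ ?_ ?_).trans
      (Real.exp_le_exp.2 (neg_le_neg (mul_le_mul_of_nonneg_right ?_ ha))))
  · intro w hw w' hw' hww'
    rw [Function.onFun, Finset.disjoint_left]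
    intro σ hσ hσ'
    simp only [K, Finset.mem_image] at hσ hσ'
    obtain ⟨τ, hτ, rfl⟩ := hσ
    obtain ⟨τ', hτ', h⟩ := hσ'
    have : w' ∈ insert w τ := h ▸ Finset.mem_insert_self w' τ'
    rcases Finset.mem_insert.1 this with h | h
    · exact hww' h.symm
    · exact (Finset.mem_sdiff.1 (Finset.mem_coe.1 hw')).2 (((hP τ).1 hτ).1 h)
  · intro w _ x y hxy
    simp only [Set.mem_ofPred_eq, eq_iff_iff]
    exact forall₂_congr fun i hi => by rw [hxy i hi]
  · intro w hw
    have hwT : w ∉ T := (Finset.mem_sdiff.1 hw).2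
    have hwτ : ∀ τ ∈ P, w ∉ τ := fun τ hτ h => hwT (((hP τ).1 hτ).1 h)
    let f : ℕ → ℝ := fun j => if j = 0 then p₀ else if j = 1 then p₁ else if j = 2 then p₂ else 1
    rw [coinMeasure_real_forall, Finset.prod_image]
    · have h1 : ∏ τ ∈ P, (q (insert w τ) : ℝ) = ∏ τ ∈ T.powerset, f τ.card := by
        rw [Finset.prod_filter]
        refine Finset.prod_congr rfl fun τ hτ => ?_
        by_cases hc : τ.card ≤ 2
        · have hi : (insert w τ).card = τ.card + 1 :=
            Finset.card_insert_of_notMem fun h => hwT (Finset.mem_powerset.1 hτ h)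
          rw [if_pos hc]
          obtain h | h | h : τ.card = 0 ∨ τ.card = 1 ∨ τ.card = 2 := by omega
          · rw [h₀ _ (by omega)]
            simp [f, h]
          · rw [h₁ _ (by omega)]
            simp [f, h]
          · rw [h₂ _ (by omega)]
            simp [f, h]
        · have h3 : τ.card ≠ 0 ∧ τ.card ≠ 1 ∧ τ.card ≠ 2 := by omega
          simp [f, hc, h3]
      rw [h1, Finset.prod_powerset]
      simp only [Finset.prod_powersetCard]
      have e1 : p₁ ^ 3 ≤ p₁ := pow_le_of_le_one hp₁ hp₁' (by norm_num)
      have e2 : p₂ ^ 3 ≤ p₂ := pow_le_of_le_one hp₂ hp₂' (by norm_num)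
      have e3 : p₁ ^ 3 ≤ p₁ ^ 2 := pow_le_pow_of_le_one hp₁ hp₁' (by norm_num)
      have e4 : p₁ ^ 3 ≤ 1 := e1.trans hp₁'
      have e5 : p₂ ^ 3 ≤ 1 := e2.trans hp₂'
      have e6 : 0 ≤ p₁ ^ 3 := by positivity
      have e7 : 0 ≤ p₂ ^ 3 := by positivity
      obtain h | h | h | h : T.card = 0 ∨ T.card = 1 ∨ T.card = 2 ∨ T.card = 3 := by omega
      · simp [h, f]
        rw [mul_assoc]
        exact mul_le_of_le_one_right hp₀ (mul_le_one₀ e4 e7 e5)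
      · simp [h, f, Finset.prod_range_succ]
        rw [mul_assoc]
        refine mul_le_mul_of_nonneg_left ?_ hp₀
        exact (mul_le_of_le_one_right e6 e5).trans e1
      · simp [h, f, Finset.prod_range_succ]
        gcongr
      · simp [h, f, Finset.prod_range_succ, Nat.choose]
    · intro τ hτ τ' hτ' h
      have h' : insert w τ = insert w τ' := h
      rw [← Finset.erase_insert (hwτ τ hτ), h', Finset.erase_insert (hwτ τ' hτ')]
  · have h3 := Finset.card_sdiff_add_card_eq_card (Finset.subset_univ T)
    rw [Finset.card_univ, Fintype.card_fin] at h3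
    have h4 : (n : ℝ) ≤ (Finset.univ \ T).card + 3 := by exact_mod_cast (by omega)
    linarith

end MissingNeighbours

/-! ### Union bound -/

section UnionBound

/-- A lower bound for the probability that one of `s` coins succeeds, linear in `s` up to the inverse
of the success probability. -/
theorem half_mul_le_one_sub_pow {p : ℝ} (hp : 0 ≤ p) (hp' : p ≤ 1) {s : ℕ} (hs : s * p ≤ 1) :
    s * p / 2 ≤ 1 - (1 - p) ^ s := by
  have hy : 0 ≤ s * p := by positivity
  have h1 : 0 ≤ (1 - p) ^ s := pow_nonneg (by linarith) s
  have h2 : (1 - p) ^ s * (1 + s * p) ≤ 1 := by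
    calc (1 - p) ^ s * (1 + s * p) ≤ (1 - p) ^ s * (1 + p) ^ s := by
          exact mul_le_mul_of_nonneg_left (one_add_mul_le_pow (by linarith) s) h1
      _ = (1 - p ^ 2) ^ s := by rw [← mul_pow]; ring
      _ ≤ 1 := pow_le_one₀ (by nlinarith) (by nlinarith)
  nlinarith

theorem sum_erase_empty_pow_card (n : ℕ) (x : ℝ) :
    ∑ S ∈ (Finset.univ : Finset (Finset (Fin n))).erase ∅, x ^ S.card = (1 + x) ^ n - 1 := by
  have h : ∑ S : Finset (Fin n), x ^ S.card = (1 + x) ^ n := by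
    have := Finset.sum_pow_mul_eq_add_pow x 1 (Finset.univ : Finset (Fin n))
    simp only [one_pow, mul_one, Finset.powerset_univ, Finset.card_univ, Fintype.card_fin] at this
    rw [this, add_comm]
  rw [← h, ← Finset.sum_erase_add _ _ (Finset.mem_univ ∅)]
  simp

theorem measureReal_biUnion_le_sum {Ω κ : Type*} [MeasurableSpace Ω] (μ : Measure Ω)
    [IsFiniteMeasure μ] (s : Finset κ) (A : κ → Set Ω) {g : κ → ℝ}
    (h : ∀ k ∈ s, μ.real (A k) ≤ g k) : μ.real (⋃ k ∈ s, A k) ≤ ∑ k ∈ s, g k :=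
  (measureReal_biUnion_finset_le s A).trans (Finset.sum_le_sum h)

theorem pairwise_disjoint_vec_four {V : Type*} [DecidableEq V] {u v : V} {S S' : Finset V}
    (huv : u ≠ v) (hu : u ∉ S) (hv : v ∉ S) (hu' : u ∉ S') (hv' : v ∉ S') (hS : Disjoint S S') :
    Pairwise fun k l => Disjoint ((![{u}, {v}, S, S'] : Fin 4 → Finset V) k)
      ((![{u}, {v}, S, S'] : Fin 4 → Finset V) l) := by
  refine (pairwise_disjoint_on (![{u}, {v}, S, S'] : Fin 4 → Finset V)).2 fun k l hkl => ?_
  fin_cases k <;> fin_cases l <;>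
    first
    | exact absurd hkl (by decide)
    | simpa [eq_comm]

theorem pairwise_disjoint_vec_three {V : Type*} [DecidableEq V] {u v : V} {S : Finset V}
    (huv : u ≠ v) (hu : u ∉ S) (hv : v ∉ S) :
    Pairwise fun k l => Disjoint ((![{u}, {v}, S] : Fin 3 → Finset V) k)
      ((![{u}, {v}, S] : Fin 3 → Finset V) l) := by
  refine (pairwise_disjoint_on (![{u}, {v}, S] : Fin 3 → Finset V)).2 fun k l hkl => ?_
  fin_cases k <;> fin_cases l <;>
    first
    | exact absurd hkl (by decide)
    | simpa [eq_comm]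

variable {n : ℕ} {q : Finset (Fin n) → unitInterval} {p₀ p₁ p₂ : ℝ}

/-- The union bound over the vertex sets whose failure may prevent simple connectivity, for a failure
probability that is exponential in their total size. -/
theorem coinMeasure_real_not_simplyConnected_le_of_forall {r : ℕ} (hr : 2 ≤ r) {x : ℝ}
    (hx0 : 0 ≤ x) {t : ℕ} (ht1 : 1 ≤ t)
    (hCone : ∀ T : Finset (Fin n), T.card ≤ 3 →
      (coinMeasure q).real {ω | ¬ HasCone T ω} ≤ x * x ^ T.card)
    (hGrow : ∀ u v (S : Finset (Fin n)), u ≠ v → u ∉ S → v ∉ S → S.card ≤ t →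
      (coinMeasure q).real {ω | ¬ Hits ![{u}, {v}, S] ω} ≤ x ^ S.card)
    (hJoin : ∀ u v (S S' : Finset (Fin n)), u ≠ v → u ∉ S → v ∉ S → u ∉ S' → v ∉ S' →
      Disjoint S S' → S.card = t → S'.card = t →
      (coinMeasure q).real {ω | ¬ Hits ![{u}, {v}, S, S'] ω} ≤ x ^ S.card * x ^ S'.card) :
    (coinMeasure q).real {ω | ¬ SimplyConnectedSpace (realization (ofCoins r ω).1)}
      ≤ x * (1 + x) ^ n + n ^ 2 * ((1 + x) ^ n - 1) + n ^ 2 * ((1 + x) ^ n - 1) ^ 2 := by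
  classical
  -- the empty set must be left out: it would contribute `1` to the sums of `x ^ S.card`
  let E : Finset (Finset (Fin n)) := Finset.univ.erase ∅
  let Ec : Set (Finset (Fin n) → Bool) :=
    ⋃ T ∈ (Finset.univ : Finset (Finset (Fin n))), {ω | T.card ≤ 3 ∧ ¬ HasCone T ω}
  let Eg : Set (Finset (Fin n) → Bool) :=
    ⋃ z ∈ (Finset.univ : Finset (Fin n × Fin n)) ×ˢ E,
      {ω | (z.1.1 ≠ z.1.2 ∧ z.1.1 ∉ z.2 ∧ z.1.2 ∉ z.2 ∧ z.2.card ≤ t) ∧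
        ¬ Hits ![{z.1.1}, {z.1.2}, z.2] ω}
  let Ej : Set (Finset (Fin n) → Bool) :=
    ⋃ z ∈ (Finset.univ : Finset (Fin n × Fin n)) ×ˢ (E ×ˢ E),
      {ω | (z.1.1 ≠ z.1.2 ∧ z.1.1 ∉ z.2.1 ∧ z.1.2 ∉ z.2.1 ∧ z.1.1 ∉ z.2.2 ∧ z.1.2 ∉ z.2.2 ∧
        Disjoint z.2.1 z.2.2 ∧ z.2.1.card = t ∧ z.2.2.card = t) ∧
        ¬ Hits ![{z.1.1}, {z.1.2}, z.2.1, z.2.2] ω}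
  have guard : ∀ (c : Prop) (P : (Finset (Fin n) → Bool) → Prop) (y : ℝ), 0 ≤ y →
      (c → (coinMeasure q).real {ω | P ω} ≤ y) → (coinMeasure q).real {ω | c ∧ P ω} ≤ y := by
    intro c P y hy h
    by_cases hc : c
    · simpa [hc] using h hc
    · simpa [hc] using hy
  have hEc : (coinMeasure q).real Ec ≤ x * (1 + x) ^ n := by
    refine (measureReal_biUnion_le_sum _ _ _ (g := fun T => x * x ^ T.card) fun T _ =>
      guard _ (fun ω => ¬ HasCone T ω) _ (by positivity) (hCone T)).trans ?_
    have h := sum_erase_empty_pow_card n x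
    rw [← Finset.mul_sum, ← Finset.sum_erase_add _ _ (Finset.mem_univ ∅), h]
    simp
  have hpairs : ((Finset.univ : Finset (Fin n × Fin n)).card : ℝ) = n ^ 2 := by
    rw [Finset.card_univ, Fintype.card_prod, Fintype.card_fin]
    push_cast
    ring
  have hEg : (coinMeasure q).real Eg ≤ n ^ 2 * ((1 + x) ^ n - 1) := by
    refine (measureReal_biUnion_le_sum _ _ _ (g := fun z => x ^ z.2.card) ?_).trans ?_
    · rintro ⟨⟨u, v⟩, S⟩ -
      exact guard _ (fun ω => ¬ Hits ![{u}, {v}, S] ω) _ (pow_nonneg hx0 _)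
        fun ⟨h1, h2, h3, h4⟩ => hGrow u v S h1 h2 h3 h4
    rw [Finset.sum_product]
    simp only [E, sum_erase_empty_pow_card, Finset.sum_const, nsmul_eq_mul, hpairs]
    exact le_rfl
  have hEj : (coinMeasure q).real Ej ≤ n ^ 2 * ((1 + x) ^ n - 1) ^ 2 := by
    refine (measureReal_biUnion_le_sum _ _ _
      (g := fun z => x ^ z.2.1.card * x ^ z.2.2.card) ?_).trans ?_
    · rintro ⟨⟨u, v⟩, S, S'⟩ -
      exact guard _ (fun ω => ¬ Hits ![{u}, {v}, S, S'] ω) _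
        (mul_nonneg (pow_nonneg hx0 _) (pow_nonneg hx0 _))
        fun ⟨h1, h2, h3, h4, h5, h6, h7, h8⟩ => hJoin u v S S' h1 h2 h3 h4 h5 h6 h7 h8
    rw [Finset.sum_product]
    have hE2 : ∑ z ∈ E ×ˢ E, x ^ z.1.card * x ^ z.2.card = ((1 + x) ^ n - 1) ^ 2 := by
      rw [Finset.sum_product, sq, ← sum_erase_empty_pow_card, Finset.sum_mul_sum]
    simp only [hE2, Finset.sum_const, nsmul_eq_mul, hpairs]
    exact le_rfl
  have hsub : {ω | ¬ SimplyConnectedSpace (realization (ofCoins r ω).1)} ⊆ Ec ∪ Eg ∪ Ej := by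
    intro ω hω
    by_contra hn
    simp only [Set.mem_union, not_or] at hn
    obtain ⟨⟨hc, hg⟩, hj⟩ := hn
    refine hω (simplyConnectedSpace_ofCoins hr t (fun T hT => ?_)
      (fun u v S huv hu hv hne hS => ?_) (fun u v S S' huv hu hv hu' hv' hd hS hS' => ?_))
    · by_contra h
      exact hc (Set.mem_biUnion (Finset.mem_univ T) ⟨hT, h⟩)
    · by_contra h
      refine hg (Set.mem_biUnion (x := ((u, v), S)) ?_ ⟨⟨huv, hu, hv, hS⟩, h⟩)
      simpa [E] using hne.ne_empty
    · by_contra h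
      refine hj (Set.mem_biUnion (x := ((u, v), S, S')) ?_
        ⟨⟨huv, hu, hv, hu', hv', hd, hS, hS'⟩, h⟩)
      have h1 : S ≠ ∅ := by
        rintro rfl
        simp at hS
        omega
      have h2 : S' ≠ ∅ := by
        rintro rfl
        simp at hS'
        omega
      simp [E, h1, h2]
  calc (coinMeasure q).real {ω | ¬ SimplyConnectedSpace (realization (ofCoins r ω).1)}
      ≤ (coinMeasure q).real (Ec ∪ Eg ∪ Ej) := measureReal_mono hsub
    _ ≤ (coinMeasure q).real Ec + (coinMeasure q).real Eg + (coinMeasure q).real Ej :=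
        (measureReal_union_le _ _).trans (by gcongr; exact measureReal_union_le _ _)
    _ ≤ _ := by gcongr

/-- The failure probability of simple connectivity in terms of `x = exp (-m / 64)`, where `m` is,
up to lower order, the expected number of apexes of cones over a triangle graph. -/
theorem coinMeasure_real_not_simplyConnected_le {r : ℕ} (hr : 2 ≤ r)
    (h₀ : ∀ σ, σ.card = 1 → (q σ : ℝ) = p₀)
    (h₁ : ∀ σ, σ.card = 2 → (q σ : ℝ) = p₁) (h₂ : ∀ σ, σ.card = 3 → (q σ : ℝ) = p₂)
    (hp₀ : 0 < p₀) (hp₀' : p₀ ≤ 1) (hp₁ : 0 < p₁) (hp₁' : p₁ ≤ 1) (hp₂ : 0 < p₂) (hp₂' : p₂ ≤ 1)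
    (hn : 8 ≤ n) {m x : ℝ} (hm : m = n * (p₀ * p₁ ^ 3 * p₂ ^ 3)) (hm8 : 8 ≤ m)
    (hx : x = Real.exp (-(m / 64))) :
    (coinMeasure q).real {ω | ¬ SimplyConnectedSpace (realization (ofCoins r ω).1)}
      ≤ x * (1 + x) ^ n + n ^ 2 * ((1 + x) ^ n - 1) + n ^ 2 * ((1 + x) ^ n - 1) ^ 2 := by
  classical
  have hx0 : 0 < x := hx ▸ Real.exp_pos _
  have hx1 : x ≤ 1 := hx ▸ Real.exp_le_one_iff.2 (by linarith)
  have hxpow : ∀ j : ℕ, ∀ y : ℝ, m / 64 * j ≤ y → Real.exp (-y) ≤ x ^ j := by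
    intro j y hy
    rw [hx, ← Real.exp_nat_mul]
    exact Real.exp_le_exp.2 (by linarith)
  have hn8 : (8 : ℝ) ≤ n := by exact_mod_cast hn
  have hp₂3 : p₂ ^ 3 ≤ 1 := pow_le_one₀ hp₂.le hp₂'
  have hmle : m ≤ n * (p₀ * p₁ ^ 3) := by
    rw [hm]
    exact mul_le_mul_of_nonneg_left (mul_le_of_le_one_right (by positivity) hp₂3) (by positivity)
  have hnp : 8 ≤ n * p₁ := by
    have h3 : p₀ * p₁ ^ 3 ≤ p₁ :=
      (mul_le_of_le_one_left (by positivity) hp₀').trans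
        (pow_le_of_le_one hp₁.le hp₁' (by norm_num))
    nlinarith
  -- up to the size `t ≈ 1 / p₁`, the probability of being joined to a set is linear in its size
  obtain ⟨t, ht⟩ : ∃ t, t = ⌊1 / p₁⌋₊ := ⟨_, rfl⟩
  have htp : t * p₁ ≤ 1 := by
    rw [ht, ← le_div_iff₀ hp₁]
    exact Nat.floor_le (by positivity)
  have ht1 : 1 ≤ t := by
    rw [ht, Nat.one_le_floor_iff, le_div_iff₀ hp₁]
    linarith
  have htp' : 1 / 2 ≤ t * p₁ := by
    have h := Nat.lt_floor_add_one (1 / p₁)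
    rw [← ht, div_lt_iff₀ hp₁] at h
    have : (1 : ℝ) ≤ t := by exact_mod_cast ht1
    nlinarith
  have htn : (t : ℝ) ≤ n / 8 := by
    nlinarith
  have hedge : 1 - (1 - p₁) = p₁ := by ring
  have hCone : ∀ T : Finset (Fin n), T.card ≤ 3 →
      (coinMeasure q).real {ω | ¬ HasCone T ω} ≤ x * x ^ T.card := by
    intro T hT
    refine (coinMeasure_real_not_hasCone_le h₀ h₁ h₂ hp₀.le hp₁.le hp₁' hp₂.le hp₂' hT).trans ?_
    rw [← pow_succ']
    refine (hxpow 4 _ ?_).trans (pow_le_pow_of_le_one hx0.le hx1 (by omega))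
    have : 0 ≤ p₀ * p₁ ^ 3 * p₂ ^ 3 := by positivity
    rw [hm]
    push_cast
    nlinarith
  have hGrow : ∀ u v (S : Finset (Fin n)), u ≠ v → u ∉ S → v ∉ S → S.card ≤ t →
      (coinMeasure q).real {ω | ¬ Hits ![{u}, {v}, S] ω} ≤ x ^ S.card := by
    intro u v S huv hu hv hS
    have hSt : (S.card : ℝ) ≤ t := by exact_mod_cast hS
    have hdisj := pairwise_disjoint_vec_three huv hu hv
    have hhalf := half_mul_le_one_sub_pow hp₁.le hp₁'
      ((mul_le_mul_of_nonneg_right hSt hp₁.le).trans htp)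
    refine (coinMeasure_real_not_hits_le h₀ h₁ hdisj (a := p₀ * (p₁ * (p₁ * (S.card * p₁ / 2))))
      (b := n / 2) (by positivity) ?_ ?_).trans (hxpow _ _ ?_)
    · simp only [Fin.prod_univ_three, Matrix.cons_val, Finset.card_singleton, pow_one, hedge]
      rw [mul_assoc p₁]
      gcongr
    · simp only [Fin.sum_univ_three, Matrix.cons_val, Finset.card_singleton]
      push_cast
      linarith
    · have : m * S.card ≤ n * (p₀ * p₁ ^ 3) * S.card :=
        mul_le_mul_of_nonneg_right hmle (Nat.cast_nonneg _)
      have h0 : 0 ≤ n * (p₀ * p₁ ^ 3) * S.card := by positivity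
      have e : (n : ℝ) / 2 * (p₀ * (p₁ * (p₁ * (S.card * p₁ / 2))))
        = n * (p₀ * p₁ ^ 3) * S.card / 4 := by ring
      rw [e]
      linarith
  have hJoin : ∀ u v (S S' : Finset (Fin n)), u ≠ v → u ∉ S → v ∉ S → u ∉ S' → v ∉ S' →
      Disjoint S S' → S.card = t → S'.card = t →
      (coinMeasure q).real {ω | ¬ Hits ![{u}, {v}, S, S'] ω} ≤ x ^ S.card * x ^ S'.card := by
    intro u v S S' huv hu hv hu' hv' hSS' hS hS'
    have hdisj := pairwise_disjoint_vec_four huv hu hv hu' hv' hSS'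
    have hhalf := half_mul_le_one_sub_pow hp₁.le hp₁' htp
    have hquarter : 1 / 4 ≤ 1 - (1 - p₁) ^ t := by linarith
    rw [← pow_add, hS, hS']
    refine (coinMeasure_real_not_hits_le h₀ h₁ hdisj (a := p₀ * (p₁ * (p₁ * (1 / 4 * (1 / 4)))))
      (b := n / 2) (by positivity) ?_ ?_).trans (hxpow _ _ ?_)
    · simp only [Fin.prod_univ_four, Matrix.cons_val, Finset.card_singleton, pow_one, hedge, hS,
        hS']
      rw [mul_assoc (p₁ * p₁), mul_assoc p₁]
      gcongr
    · simp only [Fin.sum_univ_four, Matrix.cons_val, Finset.card_singleton, hS, hS']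
      push_cast
      linarith
    · have h1 : m * t ≤ n * (p₀ * p₁ ^ 3) * t :=
        mul_le_mul_of_nonneg_right hmle (Nat.cast_nonneg _)
      have h2 : n * (p₀ * p₁ ^ 2) * (t * p₁) ≤ n * (p₀ * p₁ ^ 2) * 1 :=
        mul_le_mul_of_nonneg_left htp (by positivity)
      push_cast
      linarith
  exact coinMeasure_real_not_simplyConnected_le_of_forall hr hx0.le ht1 hCone hGrow hJoin

end UnionBound

/-! ### Asymptotics -/

/-- If `x ≤ n⁻⁴`, then `(1 + x) ^ n - 1` is of order `n x ≤ n⁻³`, which absorbs the factor `n²`. -/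
theorem failure_bound_le {n : ℕ} (hn : 1 ≤ n) {x : ℝ} (hx0 : 0 ≤ x) (hx : x ≤ ((n : ℝ) ^ 4)⁻¹) :
    x * (1 + x) ^ n + n ^ 2 * ((1 + x) ^ n - 1) + n ^ 2 * ((1 + x) ^ n - 1) ^ 2 ≤ 9 / n := by
  have hn1 : (1 : ℝ) ≤ n := by exact_mod_cast hn
  have hn0 : (0 : ℝ) < n := by linarith
  have hnx : n * x ≤ ((n : ℝ) ^ 3)⁻¹ := by
    calc (n : ℝ) * x ≤ n * ((n : ℝ) ^ 4)⁻¹ := by gcongr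
      _ = ((n : ℝ) ^ 3)⁻¹ := by field_simp
  have h3 : ((n : ℝ) ^ 3)⁻¹ ≤ 1 := inv_le_one_of_one_le₀ (one_le_pow₀ hn1)
  have hnx0 : 0 ≤ n * x := by positivity
  have hpow : (1 + x) ^ n ≤ Real.exp (n * x) := by
    rw [Real.exp_nat_mul]
    have := Real.add_one_le_exp x
    gcongr
    linarith
  have hexp : Real.exp (n * x) - 1 ≤ 2 * (n * x) := by
    have := Real.abs_exp_sub_one_le (x := n * x) (by rw [abs_of_nonneg hnx0]; linarith)
    rw [abs_of_nonneg hnx0] at this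
    exact (le_abs_self _).trans this
  have hσ : (1 + x) ^ n - 1 ≤ 2 * ((n : ℝ) ^ 3)⁻¹ := by linarith
  have hσ0 : 0 ≤ (1 + x) ^ n - 1 := by
    have := one_le_pow₀ (M₀ := ℝ) (a := 1 + x) (n := n) (by linarith)
    linarith
  have h1 : x * (1 + x) ^ n ≤ (n : ℝ)⁻¹ * 3 := by
    refine mul_le_mul (hx.trans ?_) (by linarith) (by positivity) (by positivity)
    exact inv_anti₀ hn0 (le_self_pow₀ hn1 (by norm_num))
  have h2 : (n : ℝ) ^ 2 * ((1 + x) ^ n - 1) ≤ 2 * (n : ℝ)⁻¹ := by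
    calc (n : ℝ) ^ 2 * ((1 + x) ^ n - 1) ≤ n ^ 2 * (2 * ((n : ℝ) ^ 3)⁻¹) := by gcongr
      _ = 2 * (n : ℝ)⁻¹ := by field_simp
  have h4 : (n : ℝ) ^ 2 * ((1 + x) ^ n - 1) ^ 2 ≤ 2 * (n : ℝ)⁻¹ * 2 := by
    rw [sq ((1 + x) ^ n - 1), ← mul_assoc]
    exact mul_le_mul h2 (by linarith) hσ0 (by positivity)
  have h5 : 9 / (n : ℝ) = 9 * (n : ℝ)⁻¹ := by ring
  linarith

/-- The linear form governing the common neighbours of three vertices is bounded by `psi k`. -/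
theorem add_three_mul_le_psi {r k : ℕ} (hk : 3 ≤ k) {α : Fin (r + 1) → ℝ} (hα : ∀ i, 0 ≤ α i)
    {i₀ i₁ i₂ : Fin (r + 1)} (h0 : i₀.val = 0) (h1 : i₁.val = 1) (h2 : i₂.val = 2) :
    α i₀ + 3 * α i₁ + 3 * α i₂ ≤ psi k α := by
  classical
  have h01 : i₀ ≠ i₁ := fun h => by rw [h] at h0; omega
  have h02 : i₀ ≠ i₂ := fun h => by rw [h] at h0; omega
  have h12 : i₁ ≠ i₂ := fun h => by rw [h] at h1; omega
  have hsub : ∑ i ∈ {i₀, i₁, i₂}, (k.choose i : ℝ) * α i ≤ psi k α :=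
    Finset.sum_le_sum_of_subset_of_nonneg (Finset.subset_univ _) fun i _ _ =>
      mul_nonneg (Nat.cast_nonneg _) (hα i)
  rw [Finset.sum_insert (by simp [h01, h02]), Finset.sum_insert (by simp [h12]),
    Finset.sum_singleton, h0, h1, h2, Nat.choose_zero_right, Nat.choose_one_right] at hsub
  have hk' : (3 : ℝ) ≤ k := by exact_mod_cast hk
  have hc : (3 : ℝ) ≤ k.choose 2 := by exact_mod_cast Nat.choose_le_choose 2 hk
  have := mul_le_mul_of_nonneg_right hk' (hα i₁)
  have := mul_le_mul_of_nonneg_right hc (hα i₂)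
  push_cast at hsub
  linarith

/-- A quantitative form of the theorem, for probabilities at which cones over triangle graphs abound. -/
theorem prob_simplyConnected_ge {n r : ℕ} (hr : 2 ≤ r) (hn : 8 ≤ n)
    (p : Fin (r + 1) → unitInterval) (hp : ∀ i, 0 < (p i : ℝ)) {i₀ i₁ i₂ : Fin (r + 1)}
    (h0 : i₀.val = 0) (h1 : i₁.val = 1) (h2 : i₂.val = 2)
    (hm : 256 * Real.log n ≤ n * ((p i₀ : ℝ) * (p i₁ : ℝ) ^ 3 * (p i₂ : ℝ) ^ 3)) :
    1 - 9 / (n : ℝ) ≤ prob (fun i => (p i : ℝ))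
      {Y : Omega n r | SimplyConnectedSpace (realization Y.1)} := by
  have hn0 : (0 : ℝ) < n := by exact_mod_cast (by omega : 0 < n)
  -- `1 ≤ log n` turns `hm` into the bound `8 ≤ m` needed below
  have hlog : 1 ≤ Real.log n := by
    rw [Real.le_log_iff_exp_le hn0]
    have h8 : (8 : ℝ) ≤ n := by exact_mod_cast hn
    linarith [Real.exp_one_lt_d9]
  have hcoin : ∀ (i : Fin (r + 1)) (σ : Finset (Fin n)), σ.card = i.val + 1 →
      (coinProb n p σ : ℝ) = p i := by
    intro i σ h
    have h' : σ.card - 1 = i := by omega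
    have hi : σ.card - 1 < r + 1 := h' ▸ i.2
    rw [coinProb, dif_pos hi]
    exact congrArg (fun j => (p j : ℝ)) (Fin.ext h')
  have hbound := coinMeasure_real_not_simplyConnected_le hr
    (fun σ h => hcoin i₀ σ (by omega)) (fun σ h => hcoin i₁ σ (by omega))
    (fun σ h => hcoin i₂ σ (by omega)) (hp i₀) (p i₀).2.2 (hp i₁) (p i₁).2.2 (hp i₂) (p i₂).2.2
    hn rfl (by linarith) rfl
  have hx : Real.exp (-(n * ((p i₀ : ℝ) * (p i₁ : ℝ) ^ 3 * (p i₂ : ℝ) ^ 3) / 64))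
      ≤ ((n : ℝ) ^ 4)⁻¹ := by
    rw [← Real.log_le_log_iff (Real.exp_pos _) (by positivity), Real.log_exp, Real.log_inv,
      Real.log_pow]
    push_cast
    linarith
  have hfail := hbound.trans (failure_bound_le (by omega) (Real.exp_pos _).le hx)
  have hcompl := coinMeasure_real_compl (coinProb n p)
    {ω | ofCoins r ω ∈ {Y : Omega n r | SimplyConnectedSpace (realization Y.1)}}
  rw [prob_eq_coinMeasure_real]
  have heq : {ω | ofCoins r ω ∈ {Y : Omega n r | SimplyConnectedSpace (realization Y.1)}}ᶜ
      = {ω | ¬ SimplyConnectedSpace (realization (ofCoins r ω).1)} := rfl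
  rw [heq] at hcompl
  linarith

end RandomComplex

end Probability

theorem mainTheorem4 (r k : ℕ) (hk : 3 ≤ k) (hkr : k ≤ r)
    (α : ℕ → Fin (r + 1) → ℝ) (hα : ∀ n i, 0 ≤ α n i)
    (αlim : Fin (r + 1) → ℝ) (hlim : Tendsto α atTop (𝓝 αlim))
    (hdom : αlim ∈ RandomComplex.criticalDomain r k) :
    Tendsto
      (fun n : ℕ => RandomComplex.prob (fun i => (n : ℝ) ^ (-(α n i)))
        {Y : RandomComplex.Omega n r | SimplyConnectedSpace (RandomComplex.realization Y.1)})
      atTop (𝓝 1) := by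
  obtain ⟨i₀, h0⟩ : ∃ i : Fin (r + 1), i.val = 0 := ⟨⟨0, by omega⟩, rfl⟩
  obtain ⟨i₁, h1⟩ : ∃ i : Fin (r + 1), i.val = 1 := ⟨⟨1, by omega⟩, rfl⟩
  obtain ⟨i₂, h2⟩ : ∃ i : Fin (r + 1), i.val = 2 := ⟨⟨2, by omega⟩, rfl⟩
  -- the exponent of the expected number of apexes of cones over a triangle graph
  let e : (Fin (r + 1) → ℝ) → ℝ := fun a => 1 - a i₀ - 3 * a i₁ - 3 * a i₂
  have he : 0 < e αlim := by
    have := RandomComplex.add_three_mul_le_psi hk hdom.1 h0 h1 h2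
    have := hdom.2.1
    simp only [e]
    linarith
  have hcont : Continuous e := by fun_prop
  have hev : ∀ᶠ n in atTop, e αlim / 2 < e (α n) :=
    ((hcont.tendsto αlim).comp hlim).eventually (lt_mem_nhds (half_lt_self he))
  have hlog : ∀ᶠ n : ℕ in atTop, 256 * Real.log n ≤ (n : ℝ) ^ (e αlim / 2) := by
    have h := (isLittleO_log_rpow_atTop (half_pos he)).bound (c := 1 / 256) (by norm_num)
    filter_upwards [tendsto_natCast_atTop_atTop.eventually h, eventually_ge_atTop 1] with n hn hn1
    rw [Real.norm_of_nonneg (Real.log_natCast_nonneg n), Real.norm_of_nonneg (by positivity)] at hn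
    linarith
  -- `n = 0` is excluded here, and the powers lie in `[0, 1]` because the exponents are nonpositive
  have hp : ∀ n : ℕ, 1 ≤ n → ∀ i, (n : ℝ) ^ (-(α n i)) ∈ unitInterval := fun n hn i =>
    ⟨by positivity, Real.rpow_le_one_of_one_le_of_nonpos (by exact_mod_cast hn)
      (neg_nonpos.2 (hα n i))⟩
  have hlower : Tendsto (fun n : ℕ => 1 - 9 / (n : ℝ)) atTop (𝓝 1) := by
    simpa using tendsto_const_nhds.sub (tendsto_const_div_atTop_nhds_zero_nat (9 : ℝ))
  refine tendsto_of_tendsto_of_tendsto_of_le_of_le' hlower tendsto_const_nhds ?_ ?_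
  · filter_upwards [hev, hlog, eventually_ge_atTop 8] with n hn hlogn hn8
    have hn0 : (0 : ℝ) < n := by exact_mod_cast (by omega : 0 < n)
    refine RandomComplex.prob_simplyConnected_ge (by omega) hn8
      (fun i => ⟨_, hp n (by omega) i⟩) (fun i => Real.rpow_pos_of_pos hn0 _) h0 h1 h2
      (hlogn.trans ?_)
    have hpow : (n : ℝ) ^ e (α n) = n * ((n : ℝ) ^ (-(α n i₀)) * ((n : ℝ) ^ (-(α n i₁))) ^ 3 *
        ((n : ℝ) ^ (-(α n i₂))) ^ 3) := by
      rw [← Real.rpow_mul_natCast hn0.le, ← Real.rpow_mul_natCast hn0.le, ← Real.rpow_add hn0,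
        ← Real.rpow_add hn0, ← Real.rpow_one_add' hn0.le]
      · congr 1
        simp only [e]
        push_cast
        ring
      · have : 1 + (-(α n i₀) + -(α n i₁) * (3 : ℕ) + -(α n i₂) * (3 : ℕ)) = e (α n) := by
          simp only [e]
          push_cast
          ring
        rw [this]
        linarith
    rw [← hpow]
    exact Real.rpow_le_rpow_of_exponent_le (by exact_mod_cast (by omega : 1 ≤ n)) hn.le
  · filter_upwards [eventually_ge_atTop 1] with n hn
    rw [RandomComplex.prob_eq_coinMeasure_real (fun i => ⟨_, hp n hn i⟩)]
    exact MeasureTheory.measureReal_le_one
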